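/- **Cartan's second structural equation.** All manifolds are finite-dimensional, real, $C^\infty$ and without boundary. Let $G$ be a Lie group with Lie algebra $\mathfrak g=T_eG$ (with the bracket of left-invariant vector fields), and let $\pi:P\to M$ be a principal $G$-bundle with principal right action $\rho_g(p)=p\cdot g$. For $Z\in\mathfrak g$ and $p\in P$ put $Z_P(p):=\frac{d}{dt}\big|_{t=0}\,p\cdot\exp(tZ)$, i.e. $Z_P(p)$ is the image of $Z$ under the derivative at $e$ of $g\mapsto p\cdot g$; then $\zeta_p:Z\mapsto Z_P(p)$ is a linear isomorphism from $\mathfrak g$ onto the vertical space $VP_p=\ker T_p\pi$. Let a principal connection be given: a smooth vector bundle endomorphism $P_V$ of $TP$ which is a projection onto $VP$ and satisfies $P_V\circ T\rho_g=T\rho_g\circ P_V$ for all $g\in G$. Put $P_H:=\mathrm{id}-P_V$, let $\omega:=\zeta^{-1}\circ P_V\in\Omega^1(P,\mathfrak g)$ be its connection form, let $R$ be its curvature, i.e. the bundle map with $R(X,Y)=-P_V([P_HX,P_HY])$ for all vector fields $X,Y$ on $P$, and let $\Omega^\omega:=\zeta^{-1}\circ R\in\Omega^2(P,\mathfrak g)$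 be its curvature form. For $\mathfrak g$-valued forms $\alpha,\beta$ of degrees $k,l$ let $$[\alpha,\beta](X_1,\dots,X_{k+l})=\frac1{k!\,l!}\sum_{\sigma\in S_{k+l}}\operatorname{sign}(\sigma)\,[\alpha(X_{\sigma(1)},\dots,X_{\sigma(k)}),\beta(X_{\sigma(k+1)},\dots,X_{\sigma(k+l)})],$$ let $d$ be the exterior derivative, normalized so that $d\alpha(X,Y)=X(\alpha(Y))-Y(\alpha(X))-\alpha([X,Y])$ for $1$-forms $\alpha$, and let $d^\omega:=P_H^*\circ d$ be the exterior covariant derivative, where $(P_H^*\alpha)(X_1,\dots,X_k)=\alpha(P_HX_1,\dots,P_HX_k)$. Then $$\Omega^\omega=d\omega+\tfrac12[\omega,\omega]=d^\omega\omega .$$ -/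

import Mathlib

open Bundle Set Function VectorField
open scoped Manifold ContDiff

noncomputable section

section Forms

variable {E : Type*} [NormedAddCommGroup E] [NormedSpace ℝ E]
  {H : Type*} [TopologicalSpace H] (I : ModelWithCorners ℝ E H)
  (N : Type*) [TopologicalSpace N] [ChartedSpace H N]
  (W : Type*) [NormedAddCommGroup W] [NormedSpace ℝ W]

/-- `W`-valued differential `k`-forms on the manifold `N`, as fields of alternating `k`-linear maps
on the tangent spaces; smoothness is not bundled. -/
abbrev VForm (k : ℕ) : Type _ := (x : N) → TangentSpace I x [⋀^Fin k]→L[ℝ] W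

variable {I N W}

/-- The form read in the preferred chart at `x`, as a form on the model vector space. -/
def VForm.inChart {k : ℕ} (α : VForm I N W k) (x : N) : E → E [⋀^Fin k]→L[ℝ] W := fun y =>
  (α ((extChartAt I x).symm y)).compContinuousLinearMap
    (mfderivWithin 𝓘(ℝ, E) I (extChartAt I x).symm (range I) y)

/-- The exterior derivative: at `x`, read the form in the preferred chart at `x`, take the exterior
derivative in the model vector space, and pull back by the derivative of the chart. The
normalization is `dα(X, Y) = X (α Y) - Y (α X) - α [X, Y]` for `1`-forms. -/
def VForm.d {k : ℕ} (α : VForm I N W k) : VForm I N W (k + 1) := fun x =>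
  (extDerivWithin (α.inChart x) (range I) (extChartAt I x x)).compContinuousLinearMap (mfderiv I 𝓘(ℝ, E) (extChartAt I x) x)

end Forms

section Connection

variable {EF : Type*} [NormedAddCommGroup EF] [NormedSpace ℝ EF]
  {HF : Type*} [TopologicalSpace HF] (IF : ModelWithCorners ℝ EF HF)
  {F : Type*} [TopologicalSpace F] [ChartedSpace HF F] [IsManifold IF ∞ F]
  {EM : Type*} [NormedAddCommGroup EM] [NormedSpace ℝ EM]
  {HM : Type*} [TopologicalSpace HM] (IM : ModelWithCorners ℝ EM HM)
  {M : Type*} [TopologicalSpace M] [ChartedSpace HM M]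

/-- A connection on `π : F → M`, given by its vertical projection `P_V`: a smooth endomorphism of
the vector bundle `TF` which is a projection onto the vertical bundle `ker Tπ`. -/
structure BundleConnection (pr : F → M) where
  PV : (f : F) → TangentSpace IF f →L[ℝ] TangentSpace IF f
  contMDiff_PV : ContMDiff IF (IF.prod 𝓘(ℝ, EF →L[ℝ] EF)) ∞
    (fun f => TotalSpace.mk' (EF →L[ℝ] EF)
      (E := fun f : F => TangentSpace IF f →L[ℝ] TangentSpace IF f) f (PV f))
  mfderiv_PV : ∀ (f : F) (v : TangentSpace IF f), mfderiv IF IM pr f (PV f v) = 0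
  PV_of_vertical : ∀ (f : F) (v : TangentSpace IF f), mfderiv IF IM pr f v = 0 → PV f v = v

namespace BundleConnection

variable {IF IM} {pr : F → M} (C : BundleConnection IF IM pr)

/-- The horizontal projection `P_H = id - P_V`. -/
def PH (f : F) : TangentSpace IF f →L[ℝ] TangentSpace IF f :=
  ContinuousLinearMap.id ℝ (TangentSpace IF f) - C.PV f

/-- The pullback `P_H^*` of differential forms along the horizontal projection. -/
def pullPH {W : Type*} [NormedAddCommGroup W] [NormedSpace ℝ W] {k : ℕ} (α : VForm IF F W k) :
    VForm IF F W k :=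
  fun f => (α f).compContinuousLinearMap (C.PH f)

/-- The exterior covariant derivative `P_H^* ∘ d`. -/
def extCovDeriv {W : Type*} [NormedAddCommGroup W] [NormedSpace ℝ W] {k : ℕ} (α : VForm IF F W k) :
    VForm IF F W (k + 1) :=
  C.pullPH α.d

/-- The curvature of the connection on vector fields: `R(X, Y) = - P_V [P_H X, P_H Y]`. -/
def curvatureFields (X Y : (f : F) → TangentSpace IF f) (f : F) : TangentSpace IF f :=
  - C.PV f (mlieBracket IF (fun q => C.PH q (X q)) (fun q => C.PH q (Y q)) f)

lemma PV_PV (f : F) (v : TangentSpace IF f) : C.PV f (C.PV f v) = C.PV f v :=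
  C.PV_of_vertical f _ (C.mfderiv_PV f v)

lemma PV_PH (f : F) (v : TangentSpace IF f) : C.PV f (C.PH f v) = 0 := by
  simp [PH, C.PV_PV]

lemma mdiff_PH {X : (f : F) → TangentSpace IF f} {f : F}
    (hX : MDifferentiableAt IF IF.tangent (fun q => (X q : TangentBundle IF F)) f) :
    MDifferentiableAt IF IF.tangent (fun q => (C.PH q (X q) : TangentBundle IF F)) f := by
  have h1 : MDifferentiableAt IF IF.tangent (fun q => (C.PV q (X q) : TangentBundle IF F)) f :=
    MDifferentiableAt.clm_bundle_apply
      ((C.contMDiff_PV f).mdifferentiableAt (by simp)) hX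
  exact mdifferentiableAt_sub_section hX h1

lemma curvatureFields_swap (X Y : (f : F) → TangentSpace IF f) (f : F) :
    C.curvatureFields X Y f = - C.curvatureFields Y X f := by
  simp only [curvatureFields]
  rw [mlieBracket_swap_apply, map_neg]

section Tensor

variable [FiniteDimensional ℝ EF]

lemma curvatureFields_tensorial_left (f : F) (Y : (f : F) → TangentSpace IF f) :
    TensorialAt IF EF (fun X => C.curvatureFields X Y f) f where
  smul {g X} hg hX := by
    have e : (fun q => C.PH q ((g • X) q)) = g • (fun q => C.PH q (X q)) := by
      funext q; simp
    simp only [curvatureFields]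
    rw [e, mlieBracket_smul_left hg (C.mdiff_PH hX), map_add, map_smul, map_smul, C.PV_PH]
    simp
  add {X X'} hX hX' := by
    have e : (fun q => C.PH q ((X + X') q)) =
        (fun q => C.PH q (X q)) + (fun q => C.PH q (X' q)) := by
      funext q; simp
    simp only [curvatureFields]
    rw [e, mlieBracket_add_left (C.mdiff_PH hX) (C.mdiff_PH hX'), map_add, neg_add]

lemma curvatureFields_tensorial_right (f : F) (X : (f : F) → TangentSpace IF f) :
    TensorialAt IF EF (fun Y => C.curvatureFields X Y f) f where
  smul {g Y} hg hY := by
    rw [C.curvatureFields_swap, (C.curvatureFields_tensorial_left f X).smul hg hY,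
      C.curvatureFields_swap X Y, smul_neg]
  add {Y Y'} hY hY' := by
    rw [C.curvatureFields_swap, (C.curvatureFields_tensorial_left f X).add hY hY',
      C.curvatureFields_swap X Y, C.curvatureFields_swap X Y', neg_add]

/-- The curvature of the connection as a bilinear bundle map: since `R(X, Y)(f)` depends only on
`X f` and `Y f`, it may be computed with arbitrary differentiable extensions. -/
def curvature (f : F) : TangentSpace IF f →L[ℝ] TangentSpace IF f →L[ℝ] TangentSpace IF f :=
  TensorialAt.mkHom₂ (fun X Y => C.curvatureFields X Y f) f
    (fun Y _ => C.curvatureFields_tensorial_left f Y)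
    (fun X _ => C.curvatureFields_tensorial_right f X)

/-- The bundle map `R` computes `- P_V [P_H X, P_H Y]` for all vector fields. -/
lemma curvature_apply {X Y : (f : F) → TangentSpace IF f} {f : F}
    (hX : MDifferentiableAt IF IF.tangent (fun q => (X q : TangentBundle IF F)) f)
    (hY : MDifferentiableAt IF IF.tangent (fun q => (Y q : TangentBundle IF F)) f) :
    C.curvature f (X f) (Y f) =
      - C.PV f (mlieBracket IF (fun q => C.PH q (X q)) (fun q => C.PH q (Y q)) f) :=
  TensorialAt.mkHom₂_apply _ _ hX hY

lemma curvature_self (f : F) (v : TangentSpace IF f) : C.curvature f v v = 0 := by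
  have h : C.curvature f v v =
      C.curvatureFields (FiberBundle.extend EF v) (FiberBundle.extend EF v) f :=
    TensorialAt.mkHom₂_apply_eq_extend _ _ v v
  rw [h]
  simp [curvatureFields]

lemma mfderiv_curvature (f : F) (v w : TangentSpace IF f) :
    mfderiv IF IM pr f (C.curvature f v w) = 0 := by
  have h : C.curvature f v w =
      C.curvatureFields (FiberBundle.extend EF v) (FiberBundle.extend EF w) f :=
    TensorialAt.mkHom₂_apply_eq_extend _ _ v w
  rw [h, curvatureFields, map_neg, C.mfderiv_PV, neg_zero]

end Tensor

end BundleConnection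
end Connection

section LieForms

variable {EG : Type*} [NormedAddCommGroup EG] [NormedSpace ℝ EG]
  {HG : Type*} [TopologicalSpace HG] {IG : ModelWithCorners ℝ EG HG}
  {G : Type*} [TopologicalSpace G] [ChartedSpace HG G] [Group G]

/-- The Lie algebra `T_e G` with the norm of the model vector space; this norm only serves to
differentiate, and induces the topology that `T_e G` already has. -/
instance GroupLieAlgebra.instNormedAddCommGroup : NormedAddCommGroup (GroupLieAlgebra IG G) :=
  letI n : NormedAddCommGroup (GroupLieAlgebra IG G) := inferInstanceAs (NormedAddCommGroup EG)
  { (inferInstance : AddCommGroup (GroupLieAlgebra IG G)) with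
    norm := n.norm
    toMetricSpace := n.toMetricSpace.replaceTopology
      (U := (inferInstance : TopologicalSpace (GroupLieAlgebra IG G))) rfl
    dist_eq := n.dist_eq }

instance GroupLieAlgebra.instNormedSpace : NormedSpace ℝ (GroupLieAlgebra IG G) where
  norm_smul_le c v := norm_smul_le (β := EG) c v

instance GroupLieAlgebra.instFiniteDimensional [FiniteDimensional ℝ EG] :
    FiniteDimensional ℝ (GroupLieAlgebra IG G) :=
  inferInstanceAs (FiniteDimensional ℝ EG)

variable [FiniteDimensional ℝ EG] [LieGroup IG ∞ G]

/-- The Lie bracket of the Lie algebra of a Lie group, as a continuous bilinear map. -/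
def GroupLieAlgebra.bracketL :
    GroupLieAlgebra IG G →L[ℝ] GroupLieAlgebra IG G →L[ℝ] GroupLieAlgebra IG G :=
  haveI : LieGroup IG (minSmoothness ℝ 3) G := by
    rw [minSmoothness_of_isRCLikeNormedField]; infer_instance
  haveI : CompleteSpace EG := FiniteDimensional.complete ℝ EG
  LinearMap.toContinuousBilinearMap
    (LinearMap.mk₂ ℝ (fun v w : GroupLieAlgebra IG G => ⁅v, w⁆)
      (fun u v w => add_lie u v w) (fun c v w => smul_lie c v w)
      (fun u v w => lie_add u v w) (fun c v w => lie_smul c v w))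

@[simp] lemma GroupLieAlgebra.bracketL_apply (v w : GroupLieAlgebra IG G) :
    GroupLieAlgebra.bracketL v w = ⁅v, w⁆ := rfl

section Update

variable {A : Type*} {k l : ℕ} [DecidableEq (Fin (k + l))] (v : Fin (k + l) → A) (a : A)

lemma VForm.update_castAdd_left (i : Fin k) :
    (fun j : Fin k => update v (Fin.castAdd l i) a (Fin.castAdd l j)) =
      update (fun j => v (Fin.castAdd l j)) i a := by
  funext j
  by_cases h : j = i
  · subst h; simp
  · simp [update_of_ne, h]

lemma VForm.update_castAdd_right (i : Fin k) :
    (fun j : Fin l => update v (Fin.castAdd l i) a (Fin.natAdd k j)) =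
      fun j => v (Fin.natAdd k j) := by
  funext j
  rw [update_of_ne]
  simp [Fin.ext_iff]; omega

lemma VForm.update_natAdd_left (i : Fin l) :
    (fun j : Fin k => update v (Fin.natAdd k i) a (Fin.castAdd l j)) =
      fun j => v (Fin.castAdd l j) := by
  funext j
  rw [update_of_ne]
  simp [Fin.ext_iff]; omega

lemma VForm.update_natAdd_right (i : Fin l) :
    (fun j : Fin l => update v (Fin.natAdd k i) a (Fin.natAdd k j)) =
      update (fun j => v (Fin.natAdd k j)) i a := by
  funext j
  by_cases h : j = i
  · subst h; simp
  · simp [update_of_ne, h]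

end Update

variable {E : Type*} [NormedAddCommGroup E] [NormedSpace ℝ E]
  {H : Type*} [TopologicalSpace H] {I : ModelWithCorners ℝ E H}
  {N : Type*} [TopologicalSpace N] [ChartedSpace H N]

/-- The multilinear map `(X₁, …, X_{k+l}) ↦ [α(X₁, …, X_k), β(X_{k+1}, …, X_{k+l})]`. -/
def VForm.preBracket {k l : ℕ} (α : VForm I N (GroupLieAlgebra IG G) k)
    (β : VForm I N (GroupLieAlgebra IG G) l) (x : N) :
    ContinuousMultilinearMap ℝ (fun _ : Fin (k + l) => TangentSpace I x)
      (GroupLieAlgebra IG G) where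
  toFun v := ⁅α x (fun i => v (Fin.castAdd l i)), β x (fun j => v (Fin.natAdd k j))⁆
  map_update_add' {_} v i a b := by
    simp only [← GroupLieAlgebra.bracketL_apply]
    cases i using Fin.addCases with
    | left i =>
      simp only [VForm.update_castAdd_left, VForm.update_castAdd_right, ContinuousAlternatingMap.map_update_add,
        map_add, _root_.add_apply]
    | right i =>
      simp only [VForm.update_natAdd_left, VForm.update_natAdd_right, ContinuousAlternatingMap.map_update_add,
        map_add]
  map_update_smul' {_} v i c a := by
    simp only [← GroupLieAlgebra.bracketL_apply]
    cases i using Fin.addCases with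
    | left i =>
      simp only [VForm.update_castAdd_left, VForm.update_castAdd_right,
        ContinuousAlternatingMap.map_update_smul, map_smul, _root_.smul_apply]
    | right i =>
      simp only [VForm.update_natAdd_left, VForm.update_natAdd_right,
        ContinuousAlternatingMap.map_update_smul, map_smul]
  cont := by
    simp only [← GroupLieAlgebra.bracketL_apply]
    have h1 : Continuous fun v : Fin (k + l) → TangentSpace I x =>
        α x (fun i => v (Fin.castAdd l i)) :=
      (α x).cont.comp (continuous_pi fun i => continuous_apply _)
    have h2 : Continuous fun v : Fin (k + l) → TangentSpace I x =>
        β x (fun j => v (Fin.natAdd k j)) :=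
      (β x).cont.comp (continuous_pi fun i => continuous_apply _)
    exact (GroupLieAlgebra.bracketL.continuous.comp h1).clm_apply h2

/-- The bracket of Lie-algebra-valued forms:
`[α, β](X₁, …, X_{k+l}) = 1 / (k! l!) ∑_σ sign σ [α(X_{σ 1}, …), β(X_{σ (k+1)}, …)]`. -/
def VForm.bracket {k l : ℕ} (α : VForm I N (GroupLieAlgebra IG G) k)
    (β : VForm I N (GroupLieAlgebra IG G) l) : VForm I N (GroupLieAlgebra IG G) (k + l) :=
  fun x => (1 / ((k.factorial : ℝ) * (l.factorial : ℝ))) •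
    ContinuousMultilinearMap.alternatization (VForm.preBracket α β x)

lemma VForm.bracket_apply {k l : ℕ} (α : VForm I N (GroupLieAlgebra IG G) k)
    (β : VForm I N (GroupLieAlgebra IG G) l) (x : N) (X : Fin (k + l) → TangentSpace I x) :
    VForm.bracket α β x X = (1 / ((k.factorial : ℝ) * (l.factorial : ℝ))) •
      ∑ σ : Equiv.Perm (Fin (k + l)), Equiv.Perm.sign σ •
        ⁅α x (fun i => X (σ (Fin.castAdd l i))), β x (fun j => X (σ (Fin.natAdd k j)))⁆ := by
  simp only [VForm.bracket, ContinuousAlternatingMap.smul_apply,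
    ContinuousMultilinearMap.alternatization_apply_apply]
  rfl

end LieForms

section Principal

variable {EP : Type*} [NormedAddCommGroup EP] [NormedSpace ℝ EP]
  {HP : Type*} [TopologicalSpace HP] (IP : ModelWithCorners ℝ EP HP)
  (P : Type*) [TopologicalSpace P] [ChartedSpace HP P]
  {EM : Type*} [NormedAddCommGroup EM] [NormedSpace ℝ EM]
  {HM : Type*} [TopologicalSpace HM] (IM : ModelWithCorners ℝ EM HM)
  (M : Type*) [TopologicalSpace M] [ChartedSpace HM M]
  {EG : Type*} [NormedAddCommGroup EG] [NormedSpace ℝ EG]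
  {HG : Type*} [TopologicalSpace HG] (IG : ModelWithCorners ℝ EG HG)
  (G : Type*) [TopologicalSpace G] [ChartedSpace HG G] [Group G]

/-- A principal `G`-bundle `proj : P → M`, with its principal right action `act p g = p · g`:
around every point of `M` there is a fibre-respecting diffeomorphism `proj ⁻¹ U ≅ U × G` that turns
the action into right multiplication. -/
structure PrincipalBundle where
  proj : P → M
  act : P → G → P
  contMDiff_proj : ContMDiff IP IM ∞ proj
  contMDiff_act : ContMDiff (IP.prod IG) IP ∞ (fun q : P × G => act q.1 q.2)
  act_one : ∀ p, act p 1 = p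
  act_mul : ∀ p g h, act p (g * h) = act (act p g) h
  proj_act : ∀ p g, proj (act p g) = proj p
  exists_trivialization : ∀ m : M, ∃ (U : Set M) (e : OpenPartialHomeomorph P (M × G)),
    IsOpen U ∧ m ∈ U ∧ e.source = proj ⁻¹' U ∧ e.target = U ×ˢ univ ∧
    ContMDiffOn IP (IM.prod IG) ∞ e e.source ∧
    ContMDiffOn (IM.prod IG) IP ∞ e.symm e.target ∧
    (∀ p ∈ e.source, (e p).1 = proj p) ∧
    (∀ p ∈ e.source, ∀ g : G, (e (act p g)).2 = (e p).2 * g)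

namespace PrincipalBundle

variable {IP P IM M IG G} (B : PrincipalBundle IP P IM M IG G)

/-- The infinitesimal action at `p`: the derivative at the identity of `g ↦ p · g`, which sends `Z`
to the value `Z_P(p)` of its fundamental vector field. -/
def fund (p : P) : GroupLieAlgebra IG G →L[ℝ] TangentSpace IP p :=
  mfderiv IG IP (fun g => B.act p g) (1 : G)

/-- The vertical tangent space `ker T_p proj`. -/
def vertical (p : P) : Submodule ℝ (TangentSpace IP p) :=
  LinearMap.ker (mfderiv IP IM B.proj p).toLinearMap

lemma mem_vertical {p : P} {v : TangentSpace IP p} :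
    v ∈ B.vertical p ↔ mfderiv IP IM B.proj p v = 0 := Iff.rfl

lemma mdifferentiableAt_act (p : P) (g : G) :
    MDifferentiableAt IG IP (fun g => B.act p g) g :=
  (B.contMDiff_act.comp (contMDiff_const.prodMk contMDiff_id)).mdifferentiableAt (by simp)

lemma mfderiv_comp_fund {E' : Type*} [NormedAddCommGroup E'] [NormedSpace ℝ E']
    {H' : Type*} [TopologicalSpace H'] {I' : ModelWithCorners ℝ E' H'}
    {N : Type*} [TopologicalSpace N] [ChartedSpace H' N] {p : P} {c : P → N}
    (hc : MDifferentiableAt IP I' c p) (Z : GroupLieAlgebra IG G) :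
    mfderiv IG I' (c ∘ fun g => B.act p g) (1 : G) Z = mfderiv IP I' c p (B.fund p Z) :=
  mfderiv_comp_apply_of_eq (I' := IP) (1 : G) hc (B.mdifferentiableAt_act p 1) (B.act_one p) Z

lemma fund_mem_vertical (p : P) (Z : GroupLieAlgebra IG G) : B.fund p Z ∈ B.vertical p := by
  rw [mem_vertical, ← B.mfderiv_comp_fund (B.contMDiff_proj.mdifferentiableAt (by simp))]
  have : (B.proj ∘ fun g => B.act p g) = fun _ => B.proj p := funext fun g => B.proj_act p g
  rw [this, mfderiv_const]
  rfl

/-- The infinitesimal action as a map into the vertical tangent space. -/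
def zetaMap (p : P) : GroupLieAlgebra IG G →ₗ[ℝ] B.vertical p :=
  (B.fund p).toLinearMap.codRestrict (B.vertical p) (B.fund_mem_vertical p)

lemma mfderiv_mul_left_bijective [LieGroup IG ∞ G] (a : G) :
    Bijective (mfderiv IG IG (fun g => a * g) (1 : G)) := by
  have d : ∀ (b g : G), MDifferentiableAt IG IG (fun g => b * g) g := fun b g =>
    (contMDiff_mul_left (I := IG) (n := ∞) (a := b)).mdifferentiableAt (by simp)
  have h1 : ∀ v, mfderiv IG IG (fun g => a⁻¹ * g) a (mfderiv IG IG (fun g => a * g) (1 : G) v)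
      = v := by
    intro v
    rw [← mfderiv_comp_apply_of_eq (I' := IG) (1 : G) (d a⁻¹ a) (d a 1) (mul_one a) v]
    have : ((fun g => a⁻¹ * g) ∘ fun g => a * g) = id := by ext; simp
    rw [this, mfderiv_id]
    rfl
  have h2 : ∀ v, mfderiv IG IG (fun g => a * g) (1 : G) (mfderiv IG IG (fun g => a⁻¹ * g) a v)
      = v := by
    intro v
    rw [← mfderiv_comp_apply_of_eq (I' := IG) a (d a 1) (d a⁻¹ a) (inv_mul_cancel a) v]
    have : ((fun g => a * g) ∘ fun g => a⁻¹ * g) = id := by ext; simp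
    rw [this, mfderiv_id]
    rfl
  exact bijective_iff_has_inverse.2 ⟨_, h1, h2⟩

/-- The infinitesimal action identifies the Lie algebra with every vertical tangent space. -/
lemma zetaMap_bijective [IsManifold IP ∞ P] [IsManifold IM ∞ M] [LieGroup IG ∞ G] (p : P) :
    Bijective (B.zetaMap p) := by
  obtain ⟨U, e, hU, hm, hs, ht, he, he', hfst, hsnd⟩ := B.exists_trivialization (B.proj p)
  have hp : p ∈ e.source := by rw [hs]; exact hm
  have hed : MDifferentiableAt IP (IM.prod IG) e p :=
    (he.mdifferentiableOn (by simp)).mdifferentiableAt (e.open_source.mem_nhds hp)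
  have hinj : Injective (mfderiv IP (IM.prod IG) e p) :=
    OpenPartialHomeomorph.MDifferentiable.mfderiv_injective
      ⟨he.mdifferentiableOn (by simp), he'.mdifferentiableOn (by simp)⟩ hp
  have hcd : MDifferentiableAt IP IG (fun q => (e q).2) p := hed.snd
  have hmul : ∀ Z, mfderiv IP IG (fun q => (e q).2) p (B.fund p Z) =
      mfderiv IG IG (fun g => (e p).2 * g) (1 : G) Z := by
    intro Z
    rw [← B.mfderiv_comp_fund hcd]
    have : ((fun q => (e q).2) ∘ fun g => B.act p g) = fun g => (e p).2 * g :=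
      funext fun g => hsnd p hp g
    rw [this]
  have hker : ∀ u : TangentSpace IP p, u ∈ B.vertical p →
      mfderiv IP IG (fun q => (e q).2) p u = 0 → u = 0 := by
    intro u hu hu2
    have h1 : mfderiv IP IM (fun q => (e q).1) p u = 0 := by
      have : (fun q => (e q).1) =ᶠ[nhds p] B.proj := by
        filter_upwards [e.open_source.mem_nhds hp] with q hq using hfst q hq
      rw [this.mfderiv_eq]
      exact hu
    have h3 : mfderiv IP (IM.prod IG) e p u = 0 := by
      have a1 := mfderiv_comp_apply (I' := IM.prod IG) (I'' := IM) (g := Prod.fst) p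
        mdifferentiableAt_fst hed u
      have a2 := mfderiv_comp_apply (I' := IM.prod IG) (I'' := IG) (g := Prod.snd) p
        mdifferentiableAt_snd hed u
      rw [mfderiv_fst] at a1
      rw [mfderiv_snd] at a2
      exact Prod.ext (a1.symm.trans h1) (a2.symm.trans hu2)
    exact hinj (h3.trans (map_zero _).symm)
  have hL := mfderiv_mul_left_bijective (IG := IG) (e p).2
  constructor
  · intro Z Z' h
    have h' : B.fund p Z = B.fund p Z' := congrArg Subtype.val h
    apply hL.1
    rw [← hmul, ← hmul, h']
  · rintro ⟨v, hv⟩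
    obtain ⟨Z, hZ⟩ := hL.2 (mfderiv IP IG (fun q => (e q).2) p v)
    refine ⟨Z, Subtype.ext ?_⟩
    have := hker (B.fund p Z - v) (sub_mem (B.fund_mem_vertical p Z) hv) (by
      rw [map_sub, hmul, hZ, sub_self])
    exact sub_eq_zero.1 this

/-- The isomorphism of the Lie algebra with the vertical tangent space at `p`, `Z ↦ Z_P(p)`. -/
def zeta [IsManifold IP ∞ P] [IsManifold IM ∞ M] [LieGroup IG ∞ G] (p : P) :
    GroupLieAlgebra IG G ≃ₗ[ℝ] B.vertical p :=
  LinearEquiv.ofBijective (B.zetaMap p) (B.zetaMap_bijective p)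

end PrincipalBundle

variable {IP P IM M IG G} [IsManifold IP ∞ P] [IsManifold IM ∞ M] [LieGroup IG ∞ G]

/-- A principal connection: a connection with `P_V ∘ T(ρ_g) = T(ρ_g) ∘ P_V` for all `g`, where
`ρ_g` is the principal right action by `g`. -/
structure PrincipalConnection (B : PrincipalBundle IP P IM M IG G) extends
    BundleConnection IP IM B.proj where
  equivariant : ∀ (g : G) (p : P) (v : TangentSpace IP p),
    PV (B.act p g) (mfderiv IP IP (fun q => B.act q g) p v) =
      mfderiv IP IP (fun q => B.act q g) p (PV p v)

namespace PrincipalConnection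

variable {B : PrincipalBundle IP P IM M IG G} (C : PrincipalConnection B)
  [FiniteDimensional ℝ EP]

/-- The vertical projection at `p`, followed by the identification of the vertical tangent space
with the Lie algebra: `ω_p = ζ_p⁻¹ ∘ P_V`. -/
def formAt (p : P) : TangentSpace IP p →L[ℝ] GroupLieAlgebra IG G :=
  haveI : FiniteDimensional ℝ (TangentSpace IP p) := inferInstanceAs (FiniteDimensional ℝ EP)
  haveI : T2Space (TangentSpace IP p) := inferInstanceAs (T2Space EP)
  LinearMap.toContinuousLinearMap
    ((B.zeta p).symm.toLinearMap ∘ₗ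
      (C.PV p).toLinearMap.codRestrict (B.vertical p) (C.mfderiv_PV p))

/-- The connection form `ω`, as a Lie-algebra-valued `1`-form. -/
def form : VForm IP P (GroupLieAlgebra IG G) 1 := fun p =>
  ContinuousAlternatingMap.ofSubsingleton ℝ (TangentSpace IP p) (GroupLieAlgebra IG G) (0 : Fin 1)
    (C.formAt p)

/-- `ω(v)_P = P_V v`. -/
lemma fund_form (p : P) (v : TangentSpace IP p) : B.fund p (C.form p ![v]) = C.PV p v :=
  congrArg Subtype.val ((B.zeta p).apply_symm_apply ⟨C.PV p v, C.mfderiv_PV p v⟩)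

/-- `ζ⁻¹ ∘ R` at `p`, as a continuous bilinear map. -/
def curvatureAt (p : P) : TangentSpace IP p →L[ℝ] TangentSpace IP p →L[ℝ] GroupLieAlgebra IG G :=
  haveI : FiniteDimensional ℝ (TangentSpace IP p) := inferInstanceAs (FiniteDimensional ℝ EP)
  haveI : T2Space (TangentSpace IP p) := inferInstanceAs (T2Space EP)
  LinearMap.toContinuousBilinearMap
    (LinearMap.mk₂ ℝ
      (fun v w => (B.zeta p).symm ⟨C.curvature p v w, C.mfderiv_curvature p v w⟩)
      (fun u v w => by rw [← map_add]; congr 1; ext1; simp)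
      (fun c v w => by rw [← map_smul]; congr 1; ext1; simp)
      (fun u v w => by rw [← map_add]; congr 1; ext1; simp)
      (fun c v w => by rw [← map_smul]; congr 1; ext1; simp))

lemma curvatureAt_self (p : P) (v : TangentSpace IP p) : C.curvatureAt p v v = 0 := by
  have h : (⟨C.curvature p v v, C.mfderiv_curvature p v v⟩ : B.vertical p) = 0 :=
    Subtype.ext (C.curvature_self p v)
  exact (congrArg (B.zeta p).symm h).trans (map_zero _)

/-- The curvature form `Ω^ω = ζ⁻¹ ∘ R`, as a Lie-algebra-valued `2`-form. -/
def curvatureForm : VForm IP P (GroupLieAlgebra IG G) 2 := fun p =>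
  { toFun := fun v => C.curvatureAt p (v 0) (v 1)
    map_update_add' := fun v i x y => by
      fin_cases i <;> simp [update_of_ne, update_self]
    map_update_smul' := fun v i c x => by
      fin_cases i <;> simp [update_of_ne, update_self]
    cont := by
      let L : EP →L[ℝ] EP →L[ℝ] GroupLieAlgebra IG G := C.curvatureAt p
      have h : Continuous fun v : Fin 2 → EP => L (v 0) (v 1) :=
        (L.continuous.comp (continuous_apply 0)).clm_apply (continuous_apply 1)
      exact h
    map_eq_zero_of_eq' := fun v i j h hij => by
      have h01 : v 0 = v 1 := by
        fin_cases i <;> fin_cases j <;> first | exact absurd rfl hij | exact h | exact h.symm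
      change C.curvatureAt p (v 0) (v 1) = 0
      rw [h01]
      exact C.curvatureAt_self p _ }

/-- `Ω^ω(v, w)_P = R(v, w)`. -/
lemma fund_curvatureForm (p : P) (v w : TangentSpace IP p) :
    B.fund p (C.curvatureForm p ![v, w]) = C.curvature p v w :=
  congrArg Subtype.val
    ((B.zeta p).apply_symm_apply ⟨C.curvature p v w, C.mfderiv_curvature p v w⟩)

end PrincipalConnection
end Principal
end

/-! The tangent space at `p` is the sum of the vertical space, whose vectors are the `B.fund p Z`,
and the horizontal space, where `ω` vanishes. Since `dω` is bilinear and alternating, it suffices to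
know it on three kinds of pairs.

Vertical–vertical: the pullback of `ω` along the orbit map `g ↦ p · g` takes the constant value `Z`
on the left-invariant field of `Z`, so it is the Maurer–Cartan form and `dω(Z_P, Z'_P) = -[Z, Z']`
(`d_form_fund_fund`). Vertical–horizontal: moving a horizontal vector by the group keeps it
horizontal, and `ω(Z_P) = Z` at every point; both derivatives in `dω(Z_P, w)` therefore vanish
(`d_form_fund_horizontal`). This is where equivariance enters. Horizontal–horizontal: `ω` kills
horizontal fields, so only `-ω([P_H X, P_H Y])` survives, which is the curvature form
(`d_form_horizontal`).

Adding up, `dω(v, w) = -[ω(v), ω(w)] + Ω^ω(v, w)`, and the first term is cancelled by `½[ω, ω]`. The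
third case alone is the equality of `Ω^ω` with `d^ω ω`.

Two analytic facts support this: `d` commutes with pullbacks (`VForm.d_pullback_apply`), and `ω`,
defined pointwise by inverting `ζ_p`, is differentiable (`PrincipalConnection.form_diffAt`). -/

open Bundle Set Function VectorField Filter Topology
open scoped Manifold ContDiff

noncomputable section

/-! ### Forms and vector fields in charts; Cartan's formula for `1`-forms. -/

section FormCalculus

variable {E : Type*} [NormedAddCommGroup E] [NormedSpace ℝ E]
  {H : Type*} [TopologicalSpace H] {I : ModelWithCorners ℝ E H}
  {N : Type*} [TopologicalSpace N] [ChartedSpace H N]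
  {E' : Type*} [NormedAddCommGroup E'] [NormedSpace ℝ E']
  {H' : Type*} [TopologicalSpace H'] {I' : ModelWithCorners ℝ E' H'}
  {N' : Type*} [TopologicalSpace N'] [ChartedSpace H' N']
  {W : Type*} [NormedAddCommGroup W] [NormedSpace ℝ W]

/-- Differentiability of a form at a point, read in the preferred chart there. -/
def VForm.DiffAt {k : ℕ} (α : VForm I N W k) (x : N) : Prop :=
  DifferentiableWithinAt ℝ (α.inChart x) (range I) (extChartAt I x x)

/-- The pullback of a form along a map. -/
def VForm.pullback {k : ℕ} (I : ModelWithCorners ℝ E H) (α : VForm I' N' W k) (f : N → N') :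
    VForm I N W k :=
  fun x => (α (f x)).compContinuousLinearMap (mfderiv I I' f x)

/-- All tangent spaces are definitionally the model space `E`, so the same vectors can be fed to the
form at both points. This replaces casts along equalities such as `p · 1 = p`. -/
lemma VForm.apply_congr {k : ℕ} (α : VForm I N W k) {x y : N} (h : x = y) (v : Fin k → E) :
    α x v = α y v := by
  subst h; rfl

lemma VForm.pullback_apply {k : ℕ} (α : VForm I' N' W k) (f : N → N') (x : N)
    (v : Fin k → TangentSpace I x) :
    α.pullback I f x v = α (f x) (fun i => mfderiv I I' f x (v i)) := rfl

lemma VForm.inChart_apply {k : ℕ} (α : VForm I N W k) (x : N) (y : E) (v : Fin k → E) :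
    α.inChart x y v = α ((extChartAt I x).symm y)
      (fun i => mfderivWithin 𝓘(ℝ, E) I (extChartAt I x).symm (range I) y (v i)) := rfl

lemma VForm.d_apply {k : ℕ} (α : VForm I N W k) (x : N) (v : Fin (k + 1) → TangentSpace I x) :
    α.d x v = extDerivWithin (α.inChart x) (range I) (extChartAt I x x)
      (fun i => mfderiv I 𝓘(ℝ, E) (extChartAt I x) x (v i)) := rfl

section IsManifold
variable [IsManifold I ∞ N]

lemma mfderiv_extChartAt_symm_apply_mfderiv (x : N) (v : TangentSpace I x) :
    mfderivWithin 𝓘(ℝ, E) I (extChartAt I x).symm (range I) (extChartAt I x x)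
      (mfderiv I 𝓘(ℝ, E) (extChartAt I x) x v) = v :=
  congrArg (fun L : E →L[ℝ] E => L v)
    (mfderivWithin_extChartAt_symm_comp_mfderiv_extChartAt' (I := I) (mem_extChartAt_source x))

lemma mfderiv_extChartAt_apply_mfderiv_symm (x : N) {y : E} (hy : y ∈ (extChartAt I x).target)
    (v : E) :
    mfderiv I 𝓘(ℝ, E) (extChartAt I x) ((extChartAt I x).symm y)
      (mfderivWithin 𝓘(ℝ, E) I (extChartAt I x).symm (range I) y v) = v :=
  congrArg (fun L : E →L[ℝ] E => L v)
    (mfderiv_extChartAt_comp_mfderivWithin_extChartAt_symm (I := I) hy)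

variable (I) in
/-- A vector field read in the preferred chart at `x`, as a field on the model vector space. -/
def vectorFieldInChart (X : (q : N) → TangentSpace I q) (x : N) (y : E) : E :=
  mpullbackWithin 𝓘(ℝ, E) I (extChartAt I x).symm X (range I) y

lemma mfderivWithin_symm_vectorFieldInChart (X : (q : N) → TangentSpace I q) (x : N)
    {y : E} (hy : y ∈ (extChartAt I x).target) :
    mfderivWithin 𝓘(ℝ, E) I (extChartAt I x).symm (range I) y
      (vectorFieldInChart I X x y : E) =
      X ((extChartAt I x).symm y) :=
  have hi : (show E →L[ℝ] E from mfderivWithin 𝓘(ℝ, E) I (extChartAt I x).symm (range I)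
      y).IsInvertible :=
    isInvertible_mfderivWithin_extChartAt_symm (I := I) hy
  hi.self_apply_inverse _

lemma VForm.inChart_vectorFieldInChart (α : VForm I N W 1) (X : (q : N) → TangentSpace I q) (x : N)
    {y : E} (hy : y ∈ (extChartAt I x).target) :
    α.inChart x y (fun _ => vectorFieldInChart I X x y) =
      α ((extChartAt I x).symm y) ![X ((extChartAt I x).symm y)] := by
  refine (VForm.inChart_apply α x y _).trans (congrArg _ (funext fun i => ?_))
  exact (mfderivWithin_symm_vectorFieldInChart X x hy).trans (by fin_cases i; rfl)

/-- Cartan's formula for `dα(X, Y)` when `α(X)` and `α(Y)` are locally constant. -/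
lemma VForm.d_apply_of_eventually_const [CompleteSpace E] {α : VForm I N W 1} {x : N}
    (hα : α.DiffAt x) {X Y : (q : N) → TangentSpace I q}
    (hX : MDifferentiableAt I I.tangent (fun q => (X q : TangentBundle I N)) x)
    (hY : MDifferentiableAt I I.tangent (fun q => (Y q : TangentBundle I N)) x)
    {a b : W} (ha : ∀ᶠ q in 𝓝 x, α q ![X q] = a) (hb : ∀ᶠ q in 𝓝 x, α q ![Y q] = b) :
    α.d x ![X x, Y x] = - α x ![mlieBracket I X Y x] := by
  let V : ((q : N) → TangentSpace I q) → E → E := fun X => vectorFieldInChart I X x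
  have hVd : ∀ {X : (q : N) → TangentSpace I q},
      MDifferentiableAt I I.tangent (fun q => (X q : TangentBundle I N)) x →
      DifferentiableWithinAt ℝ (V X) (range I) (extChartAt I x x) := by
    intro X hX
    have := (mdifferentiableWithinAt_univ.2
      hX).differentiableWithinAt_mpullbackWithin_vectorField
    rwa [preimage_univ, univ_inter] at this
  -- The field in the chart is defined by inverting the derivative of the inverse chart; at the base
  -- point this agrees with applying the derivative of the chart.
  have hVx : ∀ X : (q : N) → TangentSpace I q,
      V X (extChartAt I x x) = mfderiv I 𝓘(ℝ, E) (extChartAt I x) x (X x) := by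
    intro X
    have hi := isInvertible_mfderivWithin_extChartAt_symm (I := I) (mem_extChartAt_target x)
    have h1 : mfderivWithin 𝓘(ℝ, E) I (extChartAt I x).symm (range I) (extChartAt I x x)
        (V X (extChartAt I x x)) = X ((extChartAt I x).symm (extChartAt I x x)) :=
      mfderivWithin_symm_vectorFieldInChart X x (mem_extChartAt_target x)
    have h2 := mfderiv_extChartAt_symm_apply_mfderiv x (X x)
    have h3 : ∀ z, z = x → (X z : E) = X x := by rintro z rfl; rfl
    rw [h3 _ (extChartAt_to_inv x)] at h1
    exact hi.injective (h1.trans h2.symm)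
  -- The terms `X(α(Y))` and `Y(α(X))` of Cartan's formula, read in the chart, are derivatives of
  -- locally constant functions.
  have hconst : ∀ {X : (q : N) → TangentSpace I q} {a : W}, (∀ᶠ q in 𝓝 x, α q ![X q] = a) →
      fderivWithin ℝ (fun y => α.inChart x y (fun _ => V X y)) (range I) (extChartAt I x x)
        = 0 := by
    intro X a ha
    have h1 : ∀ᶠ y in 𝓝[range I] (extChartAt I x x),
        α.inChart x y (fun _ => V X y) = a := by
      filter_upwards [((continuousAt_extChartAt_symm x).tendsto.mono_left
        nhdsWithin_le_nhds).eventually (by rw [extChartAt_to_inv]; exact ha),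
        extChartAt_target_mem_nhdsWithin x] with y h1 h2
      exact (VForm.inChart_vectorFieldInChart α X x h2).trans h1
    rw [Filter.EventuallyEq.fderivWithin_eq (f := fun _ => a) h1
      (h1.self_of_nhdsWithin (mem_range_self _))]
    simp
  have key := extDerivWithin_apply_vectorField (V := ![V X, V Y]) hα
    (by intro i; fin_cases i; exacts [hVd hX, hVd hY])
    (I.uniqueDiffOn _ (mem_range_self _))
  rw [VForm.d_apply]
  have e1 : (fun i => mfderiv I 𝓘(ℝ, E) (extChartAt I x) x ((![X x, Y x] : Fin 2 → _) i)) =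
      fun i => (![V X, V Y] : Fin 2 → E → E) i (extChartAt I x x) := by
    funext i
    fin_cases i
    exacts [(hVx X).symm, (hVx Y).symm]
  refine (congrArg _ e1).trans (key.trans ?_)
  have z0 : (fun y => α.inChart x y ((0 : Fin 2).removeNth
      fun i => (![V X, V Y] : Fin 2 → E → E) i y)) = fun y => α.inChart x y (fun _ => V Y y) := by
    funext y; congr 1; funext i; fin_cases i; rfl
  have z1 : (fun y => α.inChart x y ((1 : Fin 2).removeNth
      fun i => (![V X, V Y] : Fin 2 → E → E) i y)) = fun y => α.inChart x y (fun _ => V X y) := by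
    funext y; congr 1; funext i; fin_cases i; rfl
  rw [Fin.sum_univ_two, z0, z1, hconst ha, hconst hb]
  simp only [_root_.zero_apply, smul_zero, add_zero, zero_sub]
  congr 1
  -- The general formula sums over pairs of fields; with two fields there is a single bracket term.
  have hs : ∀ f : Fin 1 → Fin 1 → W, ∑ i, ∑ j ≥ i, f i j = f 0 0 := by
    intro f
    rw [Fin.sum_univ_one, show Finset.Ici (0 : Fin 1) = {0} by decide, Finset.sum_singleton]
  refine (hs _).trans ?_
  simp only [Fin.val_zero, add_zero, pow_zero, one_smul]
  refine (VForm.apply_congr α (extChartAt_to_inv x) _).trans ?_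
  congr 1
  funext i
  fin_cases i
  change mfderivWithin 𝓘(ℝ, E) I (extChartAt I x).symm (range I) (extChartAt I x x)
    (lieBracketWithin ℝ (V X) (V Y) (range I) (extChartAt I x x) : E) = mlieBracket I X Y x
  rw [← mlieBracketWithin_univ, mlieBracketWithin_apply]
  simp only [preimage_univ, univ_inter]
  have hi : (show E →L[ℝ] E from mfderiv I 𝓘(ℝ, E) (extChartAt I x) x).IsInvertible :=
    isInvertible_mfderiv_extChartAt (I := I) (mem_extChartAt_source x)
  refine (hi.inverse_apply_eq.2 ?_).symm
  have := mfderiv_extChartAt_apply_mfderiv_symm x (mem_extChartAt_target (I := I) x)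
    (lieBracketWithin ℝ (V X) (V Y) (range I) (extChartAt I x x))
  rw [extChartAt_to_inv] at this
  exact this.symm

end IsManifold
end FormCalculus

/-! ### Naturality of the exterior derivative under smooth maps. -/

section Naturality

variable {E : Type*} [NormedAddCommGroup E] [NormedSpace ℝ E]
  {H : Type*} [TopologicalSpace H] {I : ModelWithCorners ℝ E H}
  {N : Type*} [TopologicalSpace N] [ChartedSpace H N]
  {E' : Type*} [NormedAddCommGroup E'] [NormedSpace ℝ E']
  {H' : Type*} [TopologicalSpace H'] {I' : ModelWithCorners ℝ E' H'}
  {N' : Type*} [TopologicalSpace N'] [ChartedSpace H' N']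
  {W : Type*} [NormedAddCommGroup W] [NormedSpace ℝ W]

lemma mfderiv_congr_point_apply {f : N → N'} {x y : N} (h : x = y) (v : E) :
    (mfderiv I I' f x v : E') = mfderiv I I' f y v := by
  subst h; rfl

lemma writtenInExtChartAt_extChartAt_self {f : N → N'} {x : N} :
    writtenInExtChartAt I I' x f (extChartAt I x x) = extChartAt I' (f x) (f x) := by
  simp [writtenInExtChartAt]

lemma contDiffWithinAt_writtenInExtChartAt {f : N → N'} {x : N} (hf : ContMDiffAt I I' ∞ f x) :
    ContDiffWithinAt ℝ ∞ (writtenInExtChartAt I I' x f) (range I) (extChartAt I x x) :=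
  (contMDiffAt_iff.1 hf).2

variable [IsManifold I ∞ N] [IsManifold I' ∞ N']

/-- The derivative of a map read in the preferred charts at `x` and `f x`. -/
lemma fderivWithin_writtenInExtChartAt_apply {f : N → N'} {x : N} {y : E}
    (hy : y ∈ (extChartAt I x).target)
    (hfy : f ((extChartAt I x).symm y) ∈ (extChartAt I' (f x)).source)
    (hf : MDifferentiableAt I I' f ((extChartAt I x).symm y)) (v : E) :
    fderivWithin ℝ (writtenInExtChartAt I I' x f) (range I) y v =
      mfderiv I' 𝓘(ℝ, E') (extChartAt I' (f x)) (f ((extChartAt I x).symm y))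
        (mfderiv I I' f ((extChartAt I x).symm y)
          (mfderivWithin 𝓘(ℝ, E) I (extChartAt I x).symm (range I) y v)) := by
  have U : UniqueMDiffWithinAt 𝓘(ℝ, E) (range I) y :=
    I.uniqueMDiffOn _ (extChartAt_target_subset_range x hy)
  have hs := mdifferentiableWithinAt_extChartAt_symm (I := I) hy
  have hc := mdifferentiableAt_extChartAt (I := I') ((extChartAt_source I' (f x)) ▸ hfy)
  rw [← mfderivWithin_eq_fderivWithin]
  have e : writtenInExtChartAt I I' x f =
      extChartAt I' (f x) ∘ (f ∘ (extChartAt I x).symm) := rfl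
  rw [e, mfderiv_comp_mfderivWithin (I' := I') y hc
    (MDifferentiableAt.comp_mdifferentiableWithinAt (I' := I) y hf hs) U,
    mfderiv_comp_mfderivWithin (I' := I) y hf hs U]
  rfl

/-- Chain rule: the derivative of the chart at `f x`, coming from the local expression of `f`,
cancels against the derivative of its inverse in the chart reading of `α`. -/
lemma VForm.inChart_pullback {k : ℕ} (α : VForm I' N' W k) {f : N → N'} {x : N} {y : E}
    (hy : y ∈ (extChartAt I x).target)
    (hfy : f ((extChartAt I x).symm y) ∈ (extChartAt I' (f x)).source)
    (hf : MDifferentiableAt I I' f ((extChartAt I x).symm y)) :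
    (α.pullback I f).inChart x y =
      (α.inChart (f x) (writtenInExtChartAt I I' x f y)).compContinuousLinearMap
        (fderivWithin ℝ (writtenInExtChartAt I I' x f) (range I) y) := by
  ext v
  refine (VForm.inChart_apply _ _ _ _).trans ((VForm.pullback_apply α f _ _).trans ?_)
  refine Eq.trans ?_ (VForm.inChart_apply α (f x) _ _).symm
  refine Eq.trans ?_ (VForm.apply_congr α ((extChartAt I' (f x)).left_inv hfy) _).symm
  congr 1
  funext i
  have h1 := fderivWithin_writtenInExtChartAt_apply hy hfy hf (v i)
  have h2 := congrArg (fun L : E' →L[ℝ] E' => L (mfderiv I I' f ((extChartAt I x).symm y)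
          (mfderivWithin 𝓘(ℝ, E) I (extChartAt I x).symm (range I) y (v i))))
    (mfderivWithin_extChartAt_symm_comp_mfderiv_extChartAt' (I := I') hfy)
  refine h2.symm.trans ?_
  exact congrArg (fun u : E' => (show E' from mfderivWithin 𝓘(ℝ, E') I' (extChartAt I' (f x)).symm
    (range I') (extChartAt I' (f x) (f ((extChartAt I x).symm y))) u)) h1.symm

lemma VForm.eventually_inChart_pullback {k : ℕ} (α : VForm I' N' W k) {f : N → N'} {x : N}
    (hf : ContMDiffAt I I' ∞ f x) :
    (α.pullback I f).inChart x =ᶠ[𝓝[range I] (extChartAt I x x)] fun y =>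
      (α.inChart (f x) (writtenInExtChartAt I I' x f y)).compContinuousLinearMap
        (fderivWithin ℝ (writtenInExtChartAt I I' x f) (range I) y) := by
  have h1 : ∀ᶠ q in 𝓝 x, MDifferentiableAt I I' f q := by
    filter_upwards [(contMDiffAt_iff_contMDiffAt_nhds (n := 1) (by simp)).1
      (hf.of_le (by simp))] with q hq using hq.mdifferentiableAt (by simp)
  have h2 : ∀ᶠ q in 𝓝 x, f q ∈ (extChartAt I' (f x)).source :=
    hf.continuousAt.eventually (extChartAt_source_mem_nhds (f x))
  have ht : Tendsto (extChartAt I x).symm (𝓝[range I] (extChartAt I x x)) (𝓝 x) := by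
    have := (continuousAt_extChartAt_symm (I := I) x).tendsto.mono_left
      (nhdsWithin_le_nhds (s := range I))
    rwa [extChartAt_to_inv] at this
  filter_upwards [ht.eventually h1, ht.eventually h2, extChartAt_target_mem_nhdsWithin x] with
    y h1 h2 h3 using α.inChart_pullback h3 h2 h1

lemma VForm.DiffAt.pullback {k : ℕ} {α : VForm I' N' W k} {f : N → N'} {x : N}
    (hα : α.DiffAt (f x)) (hf : ContMDiffAt I I' ∞ f x) : (α.pullback I f).DiffAt x := by
  have hF := contDiffWithinAt_writtenInExtChartAt hf
  have hx : extChartAt I x x ∈ range I := mem_range_self _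
  have he := α.eventually_inChart_pullback hf
  refine DifferentiableWithinAt.congr_of_eventuallyEq ?_ he (he.self_of_nhdsWithin hx)
  -- Product rule: one factor is the local reading of `α` along `f`, the other the derivative of the
  -- local expression of `f`, which is again `C^1`.
  refine DifferentiableWithinAt.continuousAlternatingMapCompContinuousLinearMap ?_ ?_
  · refine DifferentiableWithinAt.comp (g := α.inChart (f x)) (t := range I') _ ?_ (hF.differentiableWithinAt (by simp))
      (fun y _ => mem_range_self _)
    rw [writtenInExtChartAt_extChartAt_self]
    exact hα
  · exact (hF.fderivWithin_right (m := 1) I.uniqueDiffOn (by norm_cast) hx).differentiableWithinAt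
      (by simp)

/-- The exterior derivative commutes with pullbacks. -/
lemma VForm.d_pullback_apply {k : ℕ} {α : VForm I' N' W k} {f : N → N'} {x : N}
    (hα : α.DiffAt (f x)) (hf : ContMDiffAt I I' ∞ f x) (v : Fin (k + 1) → TangentSpace I x) :
    (α.pullback I f).d x v = α.d (f x) (fun i => mfderiv I I' f x (v i)) := by
  have hx : extChartAt I x x ∈ range I := mem_range_self _
  have he := α.eventually_inChart_pullback hf
  have hF := contDiffWithinAt_writtenInExtChartAt hf
  have hα' : DifferentiableWithinAt ℝ (α.inChart (f x)) (range I')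
      (writtenInExtChartAt I I' x f (extChartAt I x x)) := by
    rw [writtenInExtChartAt_extChartAt_self]; exact hα
  -- Naturality in the model space rests on the symmetry of second derivatives; hence the smoothness
  -- bound and the condition that the point lies in the closure of the interior of `range I`.
  have key := extDerivWithin_pullback hα' hF
    (by rw [minSmoothness_of_isRCLikeNormedField]; norm_cast) I.uniqueDiffOn
    (I.range_subset_closure_interior hx) hx (fun y _ => mem_range_self _)
  refine (VForm.d_apply _ _ _).trans (Eq.trans ?_ (VForm.d_apply _ _ _).symm)
  rw [he.extDerivWithin_eq (he.self_of_nhdsWithin hx), key, writtenInExtChartAt_extChartAt_self]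
  refine congrArg (extDerivWithin (α.inChart (f x)) (range I') (extChartAt I' (f x) (f x)))
    (funext fun i => ?_)
  have hfx := hf.mdifferentiableAt (by simp)
  have hinv := extChartAt_to_inv (I := I) x
  refine (fderivWithin_writtenInExtChartAt_apply (mem_extChartAt_target x)
    (by rw [hinv]; exact mem_extChartAt_source _) (by rw [hinv]; exact hfx) _).trans ?_
  rw [mfderiv_extChartAt_symm_apply_mfderiv]
  refine (mfderiv_congr_point_apply (congrArg f hinv) _).trans ?_
  exact congrArg (fun u : E' => (show E' from mfderiv I' 𝓘(ℝ, E') (extChartAt I' (f x)) (f x) u))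
    (mfderiv_congr_point_apply hinv _)

end Naturality

/-! ### Differentiability of a family of linear maps determined by an equation. -/

section Calculus

variable {E F G K : Type*} [NormedAddCommGroup E] [NormedSpace ℝ E]
  [NormedAddCommGroup F] [NormedSpace ℝ F] [NormedAddCommGroup G] [NormedSpace ℝ G]
  [NormedAddCommGroup K] [NormedSpace ℝ K]

variable (F G) in
/-- `ContinuousAlternatingMap.ofSubsingleton` as a continuous linear map. -/
def ContinuousAlternatingMap.ofSubsingletonCLM : (F →L[ℝ] G) →L[ℝ] F [⋀^Fin 1]→L[ℝ] G :=
  LinearMap.mkContinuous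
    { toFun := ContinuousAlternatingMap.ofSubsingleton ℝ F G (0 : Fin 1)
      map_add' := fun _ _ => rfl
      map_smul' := fun _ _ => rfl } 1 (fun f => by
        rw [one_mul]
        exact (ContinuousMultilinearMap.norm_ofSubsingleton (𝕜 := ℝ) (0 : Fin 1) f).le)

@[simp] lemma ContinuousAlternatingMap.ofSubsingletonCLM_apply (f : F →L[ℝ] G) :
    ContinuousAlternatingMap.ofSubsingletonCLM F G f =
      ContinuousAlternatingMap.ofSubsingleton ℝ F G (0 : Fin 1) f := rfl

/-- If `A y ∘ B y = Q y` with `A`, `Q` differentiable and `A x` injective, then `B` is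
differentiable. -/
lemma DifferentiableWithinAt.of_injective_comp [FiniteDimensional ℝ F] [FiniteDimensional ℝ G]
    {A : E → F →L[ℝ] G} {B : E → K →L[ℝ] F} {Q : E → K →L[ℝ] G} {s : Set E} {x : E}
    (hA : DifferentiableWithinAt ℝ A s x) (hQ : DifferentiableWithinAt ℝ Q s x) (hx : x ∈ s)
    (hinj : Injective (A x)) (h : ∀ᶠ y in 𝓝[s] x, (A y).comp (B y) = Q y) :
    DifferentiableWithinAt ℝ B s x := by
  obtain ⟨l, hl⟩ := (A x).toLinearMap.exists_leftInverse_of_injective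
    (LinearMap.ker_eq_bot.2 hinj)
  let L : G →L[ℝ] F := LinearMap.toContinuousLinearMap l
  -- `L` is a left inverse of `A x` only, but `D x = 1` and units form an open set, so `D y` is
  -- invertible near `x` and `B y = (D y)⁻¹ ∘ L ∘ Q y` there.
  let D : E → F →L[ℝ] F := fun y => L.comp (A y)
  have hD : DifferentiableWithinAt ℝ D s x := (differentiableWithinAt_const L).clm_comp hA
  have hDx : D x = 1 := by
    ext v
    exact congrArg (fun m : F →ₗ[ℝ] F => m v) hl
  have hu : ∀ᶠ y in 𝓝[s] x, IsUnit (D y) :=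
    hD.continuousWithinAt.eventually
      (Units.isOpen.mem_nhds (show IsUnit (D x) by rw [hDx]; exact isUnit_one))
  have hB : B =ᶠ[𝓝[s] x] fun y => (Ring.inverse (D y)).comp (L.comp (Q y)) := by
    have : CompleteSpace F := FiniteDimensional.complete ℝ F
    filter_upwards [h, hu] with y hy hyu
    have h1 : Ring.inverse (D y) * D y = 1 := Ring.inverse_mul_cancel _ hyu
    rw [← hy]
    ext v
    exact (congrArg (fun m : F →L[ℝ] F => m (B y v)) h1).symm
  have : CompleteSpace F := FiniteDimensional.complete ℝ F
  have hinv : DifferentiableWithinAt ℝ (fun y => Ring.inverse (D y)) s x :=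
    hD.inverse (by rw [hDx]; exact isUnit_one)
  exact (hinv.clm_comp ((differentiableWithinAt_const L).clm_comp hQ)).congr_of_eventuallyEq hB
    (hB.self_of_nhdsWithin hx)

end Calculus

/-! ### Differentiability of the connection form. -/

section ConnectionForm

variable {EP : Type*} [NormedAddCommGroup EP] [NormedSpace ℝ EP]
  {HP : Type*} [TopologicalSpace HP] {IP : ModelWithCorners ℝ EP HP}
  {P : Type*} [TopologicalSpace P] [ChartedSpace HP P]
  {EM : Type*} [NormedAddCommGroup EM] [NormedSpace ℝ EM]
  {HM : Type*} [TopologicalSpace HM] {IM : ModelWithCorners ℝ EM HM}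
  {M : Type*} [TopologicalSpace M] [ChartedSpace HM M]
  {EG : Type*} [NormedAddCommGroup EG] [NormedSpace ℝ EG]
  {HG : Type*} [TopologicalSpace HG] {IG : ModelWithCorners ℝ EG HG}
  {G : Type*} [TopologicalSpace G] [ChartedSpace HG G] [Group G]
  {B : PrincipalBundle IP P IM M IG G}

lemma ContMDiffAt.differentiableWithinAt_comp_extChartAt_symm {K : Type*} [NormedAddCommGroup K]
    [NormedSpace ℝ K] {h : P → K} {p : P} (hh : ContMDiffAt IP 𝓘(ℝ, K) ∞ h p) :
    DifferentiableWithinAt ℝ (h ∘ (extChartAt IP p).symm) (range IP) (extChartAt IP p p) :=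
  ((contMDiffAt_iff.1 hh).2).differentiableWithinAt (by simp)

variable [IsManifold IP ∞ P]

/-- The vertical projection, read in the preferred chart at `p`, is smooth. -/
lemma BundleConnection.contMDiffAt_inTangentCoordinates_PV (C : BundleConnection IP IM B.proj)
    (p : P) : ContMDiffAt IP 𝓘(ℝ, EP →L[ℝ] EP) ∞
      (inTangentCoordinates IP IP id id C.PV p) p :=
  ((contMDiffAt_hom_bundle _).1 (C.contMDiff_PV p)).2

variable [LieGroup IG ∞ G]

/-- The infinitesimal action is a partial derivative of the smooth action. Its target is the tangent
space at `B.act q 1`, which equals `q` only propositionally. -/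
lemma PrincipalBundle.contMDiffAt_inTangentCoordinates_fund (p : P) :
    ContMDiffAt IP 𝓘(ℝ, EG →L[ℝ] EP) ∞
      (inTangentCoordinates IG IP (fun _ => (1 : G)) (fun q => B.act q 1)
        (fun q => B.fund q) p) p :=
  ContMDiffAt.mfderiv (n := ∞) (fun q g => B.act q g) (fun _ : P => (1 : G))
    B.contMDiff_act.contMDiffAt contMDiffAt_const (by simp)

variable [IsManifold IM ∞ M]

lemma PrincipalBundle.fund_injective (p : P) : Injective (B.fund p) := fun _ _ h =>
  (B.zetaMap_bijective p).1 (Subtype.ext h)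

variable [FiniteDimensional ℝ EP] (C : PrincipalConnection B)

lemma PrincipalConnection.fund_formAt (p : P) (v : TangentSpace IP p) :
    B.fund p (C.formAt p v) = C.PV p v := C.fund_form p v

/-- No smooth formula for `ζ_p⁻¹` is at hand, but `ω` solves `B.fund ∘ ω = P_V`, where `B.fund` and
`P_V` are smooth and `B.fund` is injective; `DifferentiableWithinAt.of_injective_comp` applies in
the chart. -/
lemma PrincipalConnection.form_diffAt [FiniteDimensional ℝ EG] (p : P) : C.form.DiffAt p := by
  let W := GroupLieAlgebra IG G
  let c : P → EP →L[ℝ] EP := fun q => mfderiv IP 𝓘(ℝ, EP) (extChartAt IP p) q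
  let s : EP → EP →L[ℝ] EP := fun y =>
    mfderivWithin 𝓘(ℝ, EP) IP (extChartAt IP p).symm (range IP) y
  let k : EG →L[ℝ] W := mfderivWithin 𝓘(ℝ, EG) IG (extChartAt IG (1 : G)).symm (range IG)
    (extChartAt IG (1 : G) 1)
  let k' : W →L[ℝ] EG := mfderiv IG 𝓘(ℝ, EG) (extChartAt IG (1 : G)) 1
  -- `inTangentCoordinates` precomposes with the derivative `k` of the inverse chart of `G` at `1`;
  -- composing with `k'` undoes this, so that `A` is defined on the Lie algebra itself.
  let A : EP → W →L[ℝ] EP := fun y => (inTangentCoordinates IG IP (fun _ => (1 : G))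
    (fun q => B.act q 1) (fun q => B.fund q) p ((extChartAt IP p).symm y)).comp k'
  let Q : EP → EP →L[ℝ] EP := fun y => inTangentCoordinates IP IP id id C.PV p
    ((extChartAt IP p).symm y)
  let β : EP → EP →L[ℝ] W := fun y =>
    (show EP →L[ℝ] W from C.formAt ((extChartAt IP p).symm y)).comp (s y)
  have hkk : ∀ Z : W, k (k' Z) = Z := fun Z => mfderiv_extChartAt_symm_apply_mfderiv (1 : G) Z
  have hA : DifferentiableWithinAt ℝ A (range IP) (extChartAt IP p p) :=
    ((B.contMDiffAt_inTangentCoordinates_fund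
      p).differentiableWithinAt_comp_extChartAt_symm).clm_comp (differentiableWithinAt_const k')
  have hQ : DifferentiableWithinAt ℝ Q (range IP) (extChartAt IP p p) :=
    (C.contMDiffAt_inTangentCoordinates_PV p).differentiableWithinAt_comp_extChartAt_symm
  have hQe : ∀ y ∈ (extChartAt IP p).target, ∀ v : EP,
      Q y v = c ((extChartAt IP p).symm y) (C.PV ((extChartAt IP p).symm y) (s y v)) := by
    intro y hy v
    have hq : (extChartAt IP p).symm y ∈ (chartAt HP p).source :=
      extChartAt_source IP p ▸ (extChartAt IP p).map_target hy
    have := inTangentCoordinates_eq_mfderiv_comp (I := IP) (I' := IP) (f := id) (g := id)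
      (ϕ := C.PV) (x₀ := p) hq hq
    refine (congrArg (fun m : EP →L[ℝ] EP => m v) this).trans ?_
    exact congrArg (fun z : EP => c ((extChartAt IP p).symm y)
      (C.PV ((extChartAt IP p).symm y) (s z v))) ((extChartAt IP p).right_inv hy)
  have hAe : ∀ y ∈ (extChartAt IP p).target, ∀ Z : W,
      A y Z = c ((extChartAt IP p).symm y) (B.fund ((extChartAt IP p).symm y) Z) := by
    intro y hy Z
    have hq : (extChartAt IP p).symm y ∈ (chartAt HP p).source :=
      extChartAt_source IP p ▸ (extChartAt IP p).map_target hy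
    have := inTangentCoordinates_eq_mfderiv_comp (I := IG) (I' := IP) (f := fun _ => (1 : G))
      (g := fun q => B.act q 1) (ϕ := fun q => B.fund q) (x₀ := p) (mem_chart_source HG 1)
      (x := (extChartAt IP p).symm y) (by simpa only [B.act_one] using hq)
    refine (congrArg (fun m : EG →L[ℝ] EP => m (k' Z)) this).trans ?_
    -- Replaces the base points `B.act p 1` and `B.act q 1` by `p` and `q`.
    have e1 : ∀ p', p' = p → ∀ q q' : P, q' = q → ∀ u : EP,
        (show EP →L[ℝ] EP from mfderiv IP 𝓘(ℝ, EP) (extChartAt IP p') q') u =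
        (show EP →L[ℝ] EP from mfderiv IP 𝓘(ℝ, EP) (extChartAt IP p) q) u := by
      rintro _ rfl _ _ rfl _; rfl
    refine (e1 _ (B.act_one p) ((extChartAt IP p).symm y) _ (B.act_one _) _).trans ?_
    exact congrArg (fun Z : W => c ((extChartAt IP p).symm y)
      (B.fund ((extChartAt IP p).symm y) Z)) (hkk Z)
  have hβ : DifferentiableWithinAt ℝ β (range IP) (extChartAt IP p p) := by
    refine DifferentiableWithinAt.of_injective_comp hA hQ (mem_range_self _) ?_ ?_
    · intro Z Z' h
      rw [hAe _ (mem_extChartAt_target p), hAe _ (mem_extChartAt_target p)] at h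
      refine B.fund_injective _ ((?_ : Injective (c _)) h)
      have hi : (c ((extChartAt IP p).symm (extChartAt IP p p))).IsInvertible :=
        isInvertible_mfderiv_extChartAt (I := IP)
          ((extChartAt IP p).map_target (mem_extChartAt_target p))
      exact hi.injective
    · filter_upwards [extChartAt_target_mem_nhdsWithin p] with y hy
      ext v
      refine (hAe y hy _).trans (Eq.trans ?_ (hQe y hy v).symm)
      exact congrArg (fun u : EP => c ((extChartAt IP p).symm y) u) (C.fund_formAt _ _)
  exact (ContinuousAlternatingMap.ofSubsingletonCLM EP W).differentiableAt.comp_differentiableWithinAt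
    (extChartAt IP p p) hβ

end ConnectionForm

/-! ### Exterior derivative on a vector space, where constant vector fields commute. -/

section ModelSpace

variable {E W : Type*} [NormedAddCommGroup E] [NormedSpace ℝ E]
  [NormedAddCommGroup W] [NormedSpace ℝ W]

/-- A form on a vector space, as a map into alternating maps of that space. -/
def VForm.toModel {k : ℕ} (α : VForm 𝓘(ℝ, E) E W k) : E → E [⋀^Fin k]→L[ℝ] W := α

lemma VForm.inChart_modelSpace {k : ℕ} (α : VForm 𝓘(ℝ, E) E W k) (x : E) :
    α.inChart x = α.toModel := by
  funext y
  ext v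
  refine (VForm.inChart_apply α x y v).trans (congrArg (α y) (funext fun i => ?_))
  simp only [mfderivWithin_eq_fderivWithin, extChartAt_model_space_eq_id]
  refine congrArg (fun L : E →L[ℝ] E => L (v i)) (?_ : _ = ContinuousLinearMap.id ℝ E)
  simp only [modelWithCornersSelf_coe, range_id, fderivWithin_univ]
  exact fderiv_id

lemma VForm.d_modelSpace_apply {k : ℕ} (α : VForm 𝓘(ℝ, E) E W k) (x : E) (v : Fin (k + 1) → E) :
    α.d x v = extDeriv α.toModel x v := by
  refine (VForm.d_apply α x v).trans ?_
  rw [VForm.inChart_modelSpace]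
  simp only [mfderiv_eq_fderiv, extChartAt_model_space_eq_id, modelWithCornersSelf_coe, range_id,
    extDerivWithin_univ]
  refine congrArg (extDeriv α.toModel x) (funext fun i => ?_)
  exact congrArg (fun L : E →L[ℝ] E => L (v i)) (fderiv_id : _ = ContinuousLinearMap.id ℝ E)

lemma VForm.DiffAt.differentiableAt_toModel {k : ℕ} {α : VForm 𝓘(ℝ, E) E W k} {x : E}
    (h : α.DiffAt x) : DifferentiableAt ℝ α.toModel x := by
  rw [VForm.DiffAt, VForm.inChart_modelSpace] at h
  simp only [modelWithCornersSelf_coe, range_id, differentiableWithinAt_univ] at h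
  exact h

lemma fderiv_apply_eq_zero_of_eventually_const {f : E → W} {x u : E} {a : W}
    (hf : DifferentiableAt ℝ f x) (h : ∀ᶠ t in 𝓝 (0 : ℝ), f (x + t • u) = a) :
    fderiv ℝ f x u = 0 := by
  rw [← hf.lineDeriv_eq_fderiv, lineDeriv]
  exact (Filter.EventuallyEq.deriv_eq (f := fun _ => a) h).trans (deriv_const _ _)

/-- `dα(u, w) = 0` if `α(w)` is constant along the line through `x` in direction `u`, and `α(u)`
is constant along the line through `x` in direction `w`. -/
lemma VForm.d_modelSpace_apply_eq_zero {α : VForm 𝓘(ℝ, E) E W 1} {x u w : E} {a b : W}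
    (hα : α.DiffAt x) (hw : ∀ᶠ t in 𝓝 (0 : ℝ), α (x + t • u) ![w] = a)
    (hu : ∀ᶠ t in 𝓝 (0 : ℝ), α (x + t • w) ![u] = b) : α.d x ![u, w] = 0 := by
  have hd := hα.differentiableAt_toModel
  have hdv : ∀ v : E, DifferentiableAt ℝ (fun y => α.toModel y ![v]) x := fun v =>
    hd.continuousAlternatingMap_apply fun _ => differentiableAt_const _
  refine (VForm.d_modelSpace_apply α x _).trans ((extDeriv_apply hd (![u, w] : Fin 2 → E)).trans ?_)
  have z0 : (0 : Fin 2).removeNth (![u, w] : Fin 2 → E) = ![w] := by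
    funext i; fin_cases i; rfl
  have z1 : (1 : Fin 2).removeNth (![u, w] : Fin 2 → E) = ![u] := by
    funext i; fin_cases i; rfl
  rw [Fin.sum_univ_two, z0, z1]
  simp only [Matrix.cons_val_zero, Matrix.cons_val_one]
  rw [fderiv_apply_eq_zero_of_eventually_const (hdv w) hw,
    fderiv_apply_eq_zero_of_eventually_const (hdv u) hu]
  simp

end ModelSpace

/-! ### Bilinearity and antisymmetry of `2`-forms on pairs. -/

section Alternating

variable {V W : Type*} [AddCommGroup V] [Module ℝ V] [TopologicalSpace V]
  [AddCommGroup W] [Module ℝ W] [TopologicalSpace W]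

lemma ContinuousAlternatingMap.map_pair_add_left (T : V [⋀^Fin 2]→L[ℝ] W) (a b c : V) :
    T ![a + b, c] = T ![a, c] + T ![b, c] :=
  T.toAlternatingMap.map_vecCons_add ![c] a b

lemma ContinuousAlternatingMap.map_pair_swap (T : V [⋀^Fin 2]→L[ℝ] W) (a b : V) :
    T ![a, b] = - T ![b, a] := by
  have h := T.toAlternatingMap.map_swap ![b, a] (show (0 : Fin 2) ≠ 1 by decide)
  have e : (![b, a] : Fin 2 → V) ∘ Equiv.swap (0 : Fin 2) 1 = ![a, b] := by
    funext i; fin_cases i <;> simp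
  rw [e] at h
  exact h

lemma ContinuousAlternatingMap.map_pair_add_right (T : V [⋀^Fin 2]→L[ℝ] W) (a b c : V) :
    T ![a, b + c] = T ![a, b] + T ![a, c] := by
  rw [T.map_pair_swap, T.map_pair_add_left, T.map_pair_swap b, T.map_pair_swap c]
  simp [add_comm]

end Alternating

/-! ### The bracket of a Lie-algebra-valued `1`-form with itself. -/

section Bracket

variable {EG : Type*} [NormedAddCommGroup EG] [NormedSpace ℝ EG] [FiniteDimensional ℝ EG]
  {HG : Type*} [TopologicalSpace HG] {IG : ModelWithCorners ℝ EG HG}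
  {G : Type*} [TopologicalSpace G] [ChartedSpace HG G] [Group G] [LieGroup IG ∞ G]
  {E : Type*} [NormedAddCommGroup E] [NormedSpace ℝ E]
  {H : Type*} [TopologicalSpace H] {I : ModelWithCorners ℝ E H}
  {N : Type*} [TopologicalSpace N] [ChartedSpace H N]

/-- `½ [α, α](v, w) = [α(v), α(w)]` for `1`-forms. -/
lemma VForm.half_bracket_self_apply (α : VForm I N (GroupLieAlgebra IG G) 1) (x : N)
    (v w : TangentSpace I x) :
    (1 / 2 : ℝ) • VForm.bracket α α x ![v, w] = ⁅α x ![v], α x ![w]⁆ := by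
  have hinst : LieGroup IG (minSmoothness ℝ 3) G := by
    rw [minSmoothness_of_isRCLikeNormedField]; infer_instance
  have hc : CompleteSpace EG := FiniteDimensional.complete ℝ EG
  rw [VForm.bracket_apply]
  -- The sum runs over permutations of `Fin (1 + 1)`, which is `Fin 2` by unfolding.
  have hu : (Finset.univ : Finset (Equiv.Perm (Fin 2))) = {1, Equiv.swap 0 1} := by decide
  have hn : (1 : Equiv.Perm (Fin 2)) ≠ Equiv.swap 0 1 := by decide
  have h1 : ∀ u : TangentSpace I x, (fun _ : Fin 1 => u) = ![u] := fun u => by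
    funext i; fin_cases i; rfl
  have key : ∑ σ : Equiv.Perm (Fin (1 + 1)), Equiv.Perm.sign σ •
      ⁅α x (fun i => (![v, w] : Fin 2 → TangentSpace I x) (σ (Fin.castAdd 1 i))),
        α x (fun j => (![v, w] : Fin 2 → TangentSpace I x) (σ (Fin.natAdd 1 j)))⁆ =
      ⁅α x ![v], α x ![w]⁆ - ⁅α x ![w], α x ![v]⁆ := by
    refine (congrArg (fun s : Finset (Equiv.Perm (Fin 2)) => ∑ σ ∈ s, Equiv.Perm.sign σ •
      ⁅α x (fun i => (![v, w] : Fin 2 → TangentSpace I x) (σ (Fin.castAdd 1 i))),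
        α x (fun j => (![v, w] : Fin 2 → TangentSpace I x) (σ (Fin.natAdd 1 j)))⁆) hu).trans ?_
    rw [Finset.sum_pair hn, Equiv.Perm.sign_swap (by decide), Equiv.Perm.sign_one]
    have e : ∀ (σ : Equiv.Perm (Fin 2)) (a b : TangentSpace I x),
        (![v, w] : Fin 2 → TangentSpace I x) (σ 0) = a →
        (![v, w] : Fin 2 → TangentSpace I x) (σ 1) = b →
        ⁅α x (fun i => (![v, w] : Fin 2 → TangentSpace I x) (σ (Fin.castAdd 1 i))),
        α x (fun j => (![v, w] : Fin 2 → TangentSpace I x) (σ (Fin.natAdd 1 j)))⁆ =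
        ⁅α x ![a], α x ![b]⁆ := by
      rintro σ _ _ rfl rfl
      congr 2 <;> (funext i; fin_cases i; rfl)
    rw [e 1 v w rfl rfl, e (Equiv.swap 0 1) w v (by simp) (by simp)]
    simp [sub_eq_add_neg]
  -- By antisymmetry the two permutations contribute equally, which absorbs the factor `1 / 2`.
  rw [key, ← lie_skew (α x ![v]) (α x ![w])]
  simp only [Nat.factorial_one, Nat.cast_one, mul_one, div_one, one_smul]
  module

end Bracket

/-! ### `dω` on vertical and horizontal vectors, and the structure equation. -/

section StructureEquation

variable {EP : Type*} [NormedAddCommGroup EP] [NormedSpace ℝ EP]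
  {HP : Type*} [TopologicalSpace HP] {IP : ModelWithCorners ℝ EP HP}
  {P : Type*} [TopologicalSpace P] [ChartedSpace HP P]
  {EM : Type*} [NormedAddCommGroup EM] [NormedSpace ℝ EM]
  {HM : Type*} [TopologicalSpace HM] {IM : ModelWithCorners ℝ EM HM}
  {M : Type*} [TopologicalSpace M] [ChartedSpace HM M]
  {EG : Type*} [NormedAddCommGroup EG] [NormedSpace ℝ EG]
  {HG : Type*} [TopologicalSpace HG] {IG : ModelWithCorners ℝ EG HG}
  {G : Type*} [TopologicalSpace G] [ChartedSpace HG G] [Group G]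
  {B : PrincipalBundle IP P IM M IG G}

lemma mulInvariantVectorField_one (Z : GroupLieAlgebra IG G) :
    mulInvariantVectorField Z (1 : G) = Z := by
  have e : (fun h : G => 1 * h) = id := funext one_mul
  have h : ∀ f : G → G, f = id → (mfderiv IG IG f (1 : G) Z : EG) = Z := by
    rintro _ rfl; rw [mfderiv_id]; rfl
  exact h _ e

/-- Without boundary the chart target is a neighbourhood of each of its points, so smoothness on the
target is smoothness at a point. -/
lemma contMDiffAt_extChartAt_symm_of_mem [IsManifold IP ∞ P] [IP.Boundaryless] (p : P) {y : EP}
    (hy : y ∈ (extChartAt IP p).target) :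
    ContMDiffAt 𝓘(ℝ, EP) IP ∞ (extChartAt IP p).symm y :=
  (contMDiffOn_extChartAt_symm p).contMDiffAt (extChartAt_target_mem_nhds' hy)

variable [LieGroup IG ∞ G]

/-- The derivative of `g ↦ p · g` sends left-invariant fields to fundamental fields. -/
lemma PrincipalBundle.mfderiv_act_mulInvariantVectorField (p : P) (g : G)
    (Z : GroupLieAlgebra IG G) :
    mfderiv IG IP (fun g => B.act p g) g (mulInvariantVectorField Z g) = B.fund (B.act p g) Z := by
  have h := mfderiv_comp_apply_of_eq (I := IG) (I' := IG) (I'' := IP) (f := fun h : G => g * h)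
    (1 : G) (B.mdifferentiableAt_act p g)
    ((contMDiff_mul_left (I := IG) (n := ∞) (a := g)).mdifferentiableAt (by simp)) (mul_one g) Z
  have e : (fun g => B.act p g) ∘ (fun h => g * h) = fun h => B.act (B.act p g) h :=
    funext fun h => B.act_mul p g h
  rw [e] at h
  exact h.symm

variable [IsManifold IP ∞ P] [IsManifold IM ∞ M] [FiniteDimensional ℝ EP]
  (C : PrincipalConnection B)

lemma PrincipalConnection.form_fund (p : P) (Z : GroupLieAlgebra IG G) :
    C.form p ![B.fund p Z] = Z :=
  B.fund_injective p ((C.fund_form p _).trans (C.PV_of_vertical p _ (B.fund_mem_vertical p Z)))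

lemma PrincipalConnection.form_eq_zero {p : P} {v : TangentSpace IP p} (h : C.PV p v = 0) :
    C.form p ![v] = 0 :=
  B.fund_injective p (((C.fund_form p v).trans h).trans (map_zero _).symm)

variable [FiniteDimensional ℝ EG]

/-- This is the Maurer–Cartan equation for the pullback `θ` of `ω` to `G` along the orbit map.
Working on `G` avoids brackets of fundamental fields on `P`: the bracket of left-invariant fields at
`1` defines `⁅Z, Z'⁆`. -/
lemma PrincipalConnection.d_form_fund_fund (p : P) (Z Z' : GroupLieAlgebra IG G) :
    C.form.d p ![B.fund p Z, B.fund p Z'] = -⁅Z, Z'⁆ := by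
  have hinst : LieGroup IG (minSmoothness ℝ 3) G := by
    rw [minSmoothness_of_isRCLikeNormedField]; infer_instance
  have hman : IsManifold IG ∞ G := inferInstance
  have hc : CompleteSpace EG := FiniteDimensional.complete ℝ EG
  let f : G → P := fun g => B.act p g
  have hf : ContMDiff IG IP ∞ f := B.contMDiff_act.comp (contMDiff_const.prodMk contMDiff_id)
  let θ : VForm IG G (GroupLieAlgebra IG G) 1 := C.form.pullback IG f
  have hθ : ∀ (g : G) (Z : GroupLieAlgebra IG G), θ g ![mulInvariantVectorField Z g] = Z := by
    intro g Z
    refine (VForm.pullback_apply C.form f g _).trans (Eq.trans ?_ (C.form_fund (B.act p g) Z))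
    congr 1
    funext i
    fin_cases i
    exact B.mfderiv_act_mulInvariantVectorField p g Z
  have h1 := VForm.d_apply_of_eventually_const (α := θ) (x := (1 : G))
    ((C.form_diffAt (f 1)).pullback hf.contMDiffAt)
    (mdifferentiableAt_mulInvariantVectorField Z) (mdifferentiableAt_mulInvariantVectorField Z')
    (Eventually.of_forall fun g => hθ g Z) (Eventually.of_forall fun g => hθ g Z')
  have h2 := hθ 1 ⁅Z, Z'⁆
  rw [mulInvariantVectorField_one] at h2
  rw [← GroupLieAlgebra.bracket_def, h2] at h1
  refine Eq.trans ?_ h1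
  refine Eq.trans ?_ (VForm.d_pullback_apply (C.form_diffAt (f 1)) hf.contMDiffAt _).symm
  refine Eq.trans ?_ (VForm.apply_congr C.form.d (B.act_one p).symm _)
  congr 1
  funext i
  have e : ∀ Z, (B.fund p Z : EP) = mfderiv IG IP f 1 (mulInvariantVectorField Z 1) := by
    intro Z; rw [mulInvariantVectorField_one]; rfl
  fin_cases i
  exacts [e Z, e Z']

/-- Extend `v` and `w` to fields and project them horizontally: `ω` vanishes identically on the
results, so only the bracket term of Cartan's formula remains, and it is the curvature. -/
lemma PrincipalConnection.d_form_horizontal (p : P) (v w : TangentSpace IP p) :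
    C.form.d p ![C.PH p v, C.PH p w] = C.curvatureForm p ![v, w] := by
  have hc : CompleteSpace EP := FiniteDimensional.complete ℝ EP
  have hX : ∀ v : TangentSpace IP p, MDifferentiableAt IP IP.tangent
      (fun q => (FiberBundle.extend EP v q : TangentBundle IP P)) p := fun v =>
    FiberBundle.mdifferentiableAt_extend IP EP v
  have h := VForm.d_apply_of_eventually_const (C.form_diffAt p) (C.mdiff_PH (hX v))
    (C.mdiff_PH (hX w)) (Eventually.of_forall fun q => C.form_eq_zero (C.PV_PH q _))
    (Eventually.of_forall fun q => C.form_eq_zero (C.PV_PH q _))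
  rw [FiberBundle.extend_apply_self, FiberBundle.extend_apply_self] at h
  rw [h]
  apply B.fund_injective p
  rw [map_neg, C.fund_form, C.fund_curvatureForm]
  have h2 := C.curvature_apply (hX v) (hX w)
  rw [FiberBundle.extend_apply_self, FiberBundle.extend_apply_self] at h2
  exact h2.symm

/-- Pulling `ω` back along the action, with `G` and `P` replaced by charts, gives a form on the
vector space `EG × EP`. There the two vectors extend to constant, hence commuting, fields, so `d`
consists of two directional derivatives, both zero; `w` need not be extended to a horizontal field.
-/
lemma PrincipalConnection.d_form_fund_horizontal [IP.Boundaryless] [IG.Boundaryless] (p : P)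
    (Z : GroupLieAlgebra IG G) {w : TangentSpace IP p} (hw : C.PV p w = 0) :
    C.form.d p ![B.fund p Z, w] = 0 := by
  have hman : IsManifold IG ∞ G := inferInstance
  let a : EG → G := (extChartAt IG (1 : G)).symm
  let b : EP → P := (extChartAt IP p).symm
  let z₀ : EG := extChartAt IG (1 : G) 1
  let y₀ : EP := extChartAt IP p p
  have ha₀ : a z₀ = 1 := extChartAt_to_inv 1
  have hb₀ : b y₀ = p := extChartAt_to_inv p
  have ha : ∀ᶠ z in 𝓝 z₀, MDifferentiableAt 𝓘(ℝ, EG) IG a z := by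
    filter_upwards [extChartAt_target_mem_nhds (I := IG) (1 : G)] with z hz using
      (contMDiffAt_extChartAt_symm_of_mem 1 hz).mdifferentiableAt (by simp)
  have hb : ∀ᶠ y in 𝓝 y₀, MDifferentiableAt 𝓘(ℝ, EP) IP b y := by
    filter_upwards [extChartAt_target_mem_nhds (I := IP) p] with y hy using
      (contMDiffAt_extChartAt_symm_of_mem p hy).mdifferentiableAt (by simp)
  let f : EG × EP → P := fun q => B.act (b q.2) (a q.1)
  have hf₀ : f (z₀, y₀) = p := by simp only [f, ha₀, hb₀, B.act_one]
  have hf : ContMDiffAt 𝓘(ℝ, EG × EP) IP ∞ f (z₀, y₀) := by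
    have h1 : ContMDiffAt 𝓘(ℝ, EG × EP) IG ∞ (fun q : EG × EP => a q.1) (z₀, y₀) :=
      ContMDiffAt.comp (I' := 𝓘(ℝ, EG)) (z₀, y₀)
        (contMDiffAt_extChartAt_symm_of_mem 1 (mem_extChartAt_target 1))
        contDiff_fst.contMDiff.contMDiffAt
    have h2 : ContMDiffAt 𝓘(ℝ, EG × EP) IP ∞ (fun q : EG × EP => b q.2) (z₀, y₀) :=
      ContMDiffAt.comp (I' := 𝓘(ℝ, EP)) (z₀, y₀)
        (contMDiffAt_extChartAt_symm_of_mem p (mem_extChartAt_target p))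
        contDiff_snd.contMDiff.contMDiffAt
    exact B.contMDiff_act.contMDiffAt.comp (z₀, y₀) (h2.prodMk h1)
  have hfd : ∀ᶠ q in 𝓝 (z₀, y₀), MDifferentiableAt 𝓘(ℝ, EG × EP) IP f q := by
    filter_upwards [(contMDiffAt_iff_contMDiffAt_nhds (n := 1) (by simp)).1
      (hf.of_le (by simp))] with q hq using hq.mdifferentiableAt (by simp)
  have hfst : ∀ (z : EG) (y : EP) (u : EG), MDifferentiableAt 𝓘(ℝ, EG × EP) IP f (z, y) →
      MDifferentiableAt 𝓘(ℝ, EG) IG a z →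
      (mfderiv 𝓘(ℝ, EG × EP) IP f (z, y) ((u, 0) : EG × EP) : EP) =
        mfderiv IG IP (fun g => B.act (b y) g) (a z) (mfderiv 𝓘(ℝ, EG) IG a z u) := by
    intro z y u h1 h2
    have hi : HasMFDerivAt 𝓘(ℝ, EG) 𝓘(ℝ, EG × EP) (fun z : EG => (z, y)) z
        (ContinuousLinearMap.inl ℝ EG EP) := (hasFDerivAt_prodMk_left z y).hasMFDerivAt
    have e1 := mfderiv_comp_apply (I' := 𝓘(ℝ, EG × EP)) z h1 hi.mdifferentiableAt u
    have e2 := mfderiv_comp_apply (I' := IG) z (B.mdifferentiableAt_act (b y) (a z)) h2 u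
    rw [hi.mfderiv] at e1
    exact e1.symm.trans e2
  have hsnd : ∀ (z : EG) (y : EP) (u : EP), MDifferentiableAt 𝓘(ℝ, EG × EP) IP f (z, y) →
      MDifferentiableAt 𝓘(ℝ, EP) IP b y →
      (mfderiv 𝓘(ℝ, EG × EP) IP f (z, y) ((0, u) : EG × EP) : EP) =
        mfderiv IP IP (fun q => B.act q (a z)) (b y) (mfderiv 𝓘(ℝ, EP) IP b y u) := by
    intro z y u h1 h2
    have hi : HasMFDerivAt 𝓘(ℝ, EP) 𝓘(ℝ, EG × EP) (fun y : EP => (z, y)) y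
        (ContinuousLinearMap.inr ℝ EG EP) := (hasFDerivAt_prodMk_right z y).hasMFDerivAt
    have h3 : MDifferentiableAt IP IP (fun q => B.act q (a z)) (b y) :=
      (B.contMDiff_act.comp (contMDiff_id.prodMk contMDiff_const)).mdifferentiableAt (by simp)
    have e1 := mfderiv_comp_apply (I' := 𝓘(ℝ, EG × EP)) y h1 hi.mdifferentiableAt u
    have e2 := mfderiv_comp_apply (I' := IP) y h3 h2 u
    rw [hi.mfderiv] at e1
    exact e1.symm.trans e2
  let ζ : EG := mfderiv IG 𝓘(ℝ, EG) (extChartAt IG (1 : G)) 1 Z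
  let w' : EP := mfderiv IP 𝓘(ℝ, EP) (extChartAt IP p) p w
  have hζ : (mfderiv 𝓘(ℝ, EG) IG a z₀ ζ : EG) = Z := by
    have := mfderiv_extChartAt_symm_apply_mfderiv (1 : G) Z
    rwa [IG.range_eq_univ, mfderivWithin_univ] at this
  have hw' : (mfderiv 𝓘(ℝ, EP) IP b y₀ w' : EP) = w := by
    have := mfderiv_extChartAt_symm_apply_mfderiv p w
    rwa [IP.range_eq_univ, mfderivWithin_univ] at this
  have hα := (C.form_diffAt (f (z₀, y₀))).pullback hf
  have key : (C.form.pullback 𝓘(ℝ, EG × EP) f).d (z₀, y₀)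
      ![((ζ, 0) : EG × EP), ((0, w') : EG × EP)] = 0 := by
    have htz : Tendsto (fun t : ℝ => z₀ + t • ζ) (𝓝 0) (𝓝 z₀) := by
      have : Continuous fun t : ℝ => z₀ + t • ζ := by fun_prop
      simpa using this.tendsto 0
    have hty : Tendsto (fun t : ℝ => y₀ + t • w') (𝓝 0) (𝓝 y₀) := by
      have : Continuous fun t : ℝ => y₀ + t • w' := by fun_prop
      simpa using this.tendsto 0
    refine VForm.d_modelSpace_apply_eq_zero (a := 0) (b := Z) hα ?_ ?_
    -- Along the group direction `(0, w')` is mapped to the translate of `w` by a group element,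
    -- horizontal by equivariance; the constant value is `0`.
    · have h1 : ∀ᶠ t : ℝ in 𝓝 0, MDifferentiableAt 𝓘(ℝ, EG × EP) IP f (z₀ + t • ζ, y₀) :=
        (htz.prodMk_nhds tendsto_const_nhds).eventually hfd
      filter_upwards [h1] with t h1
      have e : ((z₀, y₀) + t • (ζ, 0) : EG × EP) = (z₀ + t • ζ, y₀) := by simp
      rw [e]
      refine (VForm.pullback_apply C.form f _ _).trans ?_
      have h2 := hsnd (z₀ + t • ζ) y₀ w' h1 hb.self_of_nhds
      rw [hw'] at h2
      have h3 : C.PV (B.act p (a (z₀ + t • ζ)))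
          (mfderiv IP IP (fun q => B.act q (a (z₀ + t • ζ))) p w) = 0 := by
        rw [C.equivariant, hw]; exact map_zero _
      refine Eq.trans ?_ (C.form_eq_zero h3)
      refine (VForm.apply_congr C.form
        (show f (z₀ + t • ζ, y₀) = B.act p (a (z₀ + t • ζ)) by simp only [f, hb₀]) _).trans ?_
      congr 1
      funext i
      fin_cases i
      exact h2.trans (mfderiv_congr_point_apply (E := EP) (I := IP) hb₀ w)
    -- Along the direction of `P` the group coordinate stays at `1`, so `(ζ, 0)` is mapped to the
    -- fundamental vector of `Z`; the constant value is `Z`.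
    · have h1 : ∀ᶠ t : ℝ in 𝓝 0, MDifferentiableAt 𝓘(ℝ, EG × EP) IP f (z₀, y₀ + t • w') :=
        (tendsto_const_nhds.prodMk_nhds hty).eventually hfd
      filter_upwards [h1] with t h1
      have e : ((z₀, y₀) + t • (0, w') : EG × EP) = (z₀, y₀ + t • w') := by simp
      rw [e]
      refine (VForm.pullback_apply C.form f _ _).trans ?_
      have h2 := hfst z₀ (y₀ + t • w') ζ h1 ha.self_of_nhds
      rw [hζ] at h2
      refine Eq.trans ?_ (C.form_fund (b (y₀ + t • w')) Z)
      refine (VForm.apply_congr C.form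
        (show f (z₀, y₀ + t • w') = b (y₀ + t • w') by simp only [f, ha₀, B.act_one]) _).trans ?_
      congr 1
      funext i
      fin_cases i
      exact h2.trans (mfderiv_congr_point_apply ha₀ Z)
  have h := VForm.d_pullback_apply (C.form_diffAt (f (z₀, y₀))) hf
    ![((ζ, 0) : EG × EP), ((0, w') : EG × EP)]
  rw [key] at h
  refine Eq.trans ?_ h.symm
  refine Eq.trans ?_ (VForm.apply_congr C.form.d hf₀.symm _)
  congr 1
  funext i
  have e1 := hfst z₀ y₀ ζ hfd.self_of_nhds ha.self_of_nhds
  have e2 := hsnd z₀ y₀ w' hfd.self_of_nhds hb.self_of_nhds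
  rw [hζ] at e1
  rw [hw'] at e2
  have e3 : (mfderiv IG IP (fun g => B.act (b y₀) g) (a z₀) Z : EP) = B.fund p Z := by
    rw [ha₀, hb₀]; rfl
  have e4 : (mfderiv IP IP (fun q => B.act q (a z₀)) (b y₀) w : EP) = w := by
    rw [ha₀, hb₀, show (fun q => B.act q 1) = id from funext B.act_one, mfderiv_id]; rfl
  fin_cases i
  exacts [(e1.trans e3).symm, (e2.trans e4).symm]

/-- The structure equation, evaluated on a pair of tangent vectors. -/
lemma PrincipalConnection.curvatureForm_apply [IP.Boundaryless] [IG.Boundaryless] (p : P)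
    (v w : TangentSpace IP p) :
    C.curvatureForm p ![v, w] = C.form.d p ![v, w] + ⁅C.form p ![v], C.form p ![w]⁆ := by
  have hsplit : ∀ v : TangentSpace IP p, v = B.fund p (C.form p ![v]) + C.PH p v := by
    intro v
    rw [C.fund_form, BundleConnection.PH]
    simp
  have h : C.form.d p ![v, w] =
      C.form.d p ![B.fund p (C.form p ![v]) + C.PH p v, B.fund p (C.form p ![w]) + C.PH p w] := by
    rw [← hsplit v, ← hsplit w]
  have hHV : C.form.d p ![C.PH p v, B.fund p (C.form p ![w])] = 0 := by
    rw [ContinuousAlternatingMap.map_pair_swap, C.d_form_fund_horizontal p _ (C.PV_PH p v),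
      neg_zero]
  -- The four terms of `dω(v, w)` are `-[ω(v), ω(w)]`, two zeros and `Ω^ω(v, w)`.
  rw [h, ContinuousAlternatingMap.map_pair_add_left, ContinuousAlternatingMap.map_pair_add_right,
    ContinuousAlternatingMap.map_pair_add_right, C.d_form_fund_fund,
    C.d_form_fund_horizontal p _ (C.PV_PH p w), hHV, C.d_form_horizontal]
  abel

end StructureEquation

end

/-! ### Cartan's structure equation as an equality of forms. -/

theorem mainTheorem7
    {EP : Type*} [NormedAddCommGroup EP] [NormedSpace ℝ EP] [FiniteDimensional ℝ EP]
    {HP : Type*} [TopologicalSpace HP] (IP : ModelWithCorners ℝ EP HP) [IP.Boundaryless]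
    {P : Type*} [TopologicalSpace P] [ChartedSpace HP P] [IsManifold IP ∞ P]
    {EM : Type*} [NormedAddCommGroup EM] [NormedSpace ℝ EM] [FiniteDimensional ℝ EM]
    {HM : Type*} [TopologicalSpace HM] (IM : ModelWithCorners ℝ EM HM) [IM.Boundaryless]
    {M : Type*} [TopologicalSpace M] [ChartedSpace HM M] [IsManifold IM ∞ M]
    {EG : Type*} [NormedAddCommGroup EG] [NormedSpace ℝ EG] [FiniteDimensional ℝ EG]
    {HG : Type*} [TopologicalSpace HG] (IG : ModelWithCorners ℝ EG HG) [IG.Boundaryless]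
    {G : Type*} [TopologicalSpace G] [ChartedSpace HG G] [Group G] [LieGroup IG ∞ G]
    (B : PrincipalBundle IP P IM M IG G) (C : PrincipalConnection B) :
    C.curvatureForm = C.form.d + (1 / 2 : ℝ) • VForm.bracket C.form C.form ∧
      C.form.d + (1 / 2 : ℝ) • VForm.bracket C.form C.form = C.extCovDeriv C.form := by
  have h1 : C.curvatureForm = C.form.d + (1 / 2 : ℝ) • VForm.bracket C.form C.form := by
    funext p
    ext v
    have hv : v = ![v 0, v 1] := by
      funext i; fin_cases i <;> rfl
    rw [hv]
    exact (C.curvatureForm_apply p (v 0) (v 1)).trans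
      (congrArg (C.form.d p ![v 0, v 1] + ·) (C.form.half_bracket_self_apply p (v 0) (v 1)).symm)
  refine ⟨h1, h1.symm.trans ?_⟩
  funext p
  ext v
  have hv : v = ![v 0, v 1] := by
    funext i; fin_cases i <;> rfl
  -- The covariant derivative is by definition `dω` on horizontal projections, so the horizontal
  -- case finishes.
  rw [hv, ← C.d_form_horizontal p (v 0) (v 1)]
  refine congrArg (C.form.d p) (funext fun i => ?_)
  fin_cases i <;> rfl
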